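/- **Proposition 4 (Semi-bandit guarantees).** *Setting.* Let $K\subseteq[0,1]^d$ be closed, convex and down-closed ($y\in K$, $0\le x\le y$ coordinatewise imply $x\in K$), with $\|x-y\|\le D$ on $K$, $D>0$, and let $c\in K$, $r>0$ be such that the ball of radius $r$ around $c$ within $\mathrm{aff}(K)$ lies in $K$. Let $f_0,\dots,f_{T-1}$ be a fixed sequence (oblivious adversary) of non-negative, differentiable, not necessarily monotone functions on $[0,1]^d$ that are DR-submodular ($x\le y$ implies $\nabla f_t(x)\ge\nabla f_t(y)$ on $[0,1]^d$), and on $K$ are $M_1$-Lipschitz ($\|\nabla f_t\|\le M_1$) and smooth ($\nabla f_t$ is Lipschitz). In round $t$ the player plays $X_t$ and sees only $o_t$ with $\mathbb E[o_t\mid\text{past},X_t]=\nabla f_t(X_t)$ and $\|o_t\|\le B_1$, where $B_1>0$ (semi-bandit feedback: the query is the point played). *Algorithm.* Let $L=\lceil T^{1/3}\rceil$ and split the $T$ rounds into $Q=\lceil T/L\rceil$ consecutive blocks of length $L$, the last one cut off at round $T$. Fix $v>0$ and put $\delta=vQ^{-1/2}$, $\eta=\frac{vr}{2B_1}Q^{-1/2}$;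 assume $\delta<r$. Put $x_0=c$. In block $q$ draw, freshly and independently, $z_q\in[0,1]$ with density $e^{z-1}/(1-e^{-1})$ and a uniformly random permutation of the $L$ rounds of the block; let $\tau_q$ be its first entry. In round $\tau_q$ play $1-e^{-z_qx_q}$ (coordinatewise), and in the other rounds of the block play $1-e^{-x_q}$. Then put $x_{q+1}=\mathrm{IP}(x_q+\eta\, o_{\tau_q}\odot e^{-z_qx_q})$. Here $\mathrm{IP}$ is the infeasible projection by means of a (measurable) separation oracle, which for each $y\notin K$ returns $g$ with $\langle y-x,g\rangle>0$ for all $x\in K$: project the input to $\mathrm{aff}(K)$, then to the ball of radius $D$ around $c$; as long as the current point $y$ is not in $K$, replace it by $y-\delta g'/\|g'\|$, where $g'$ is the orthogonal projection of $g$ to $\mathrm{aff}(K)-c$; return the first point that lies in $K$. *Claim.* There is a constant $C$ that depends only on $D$, $r$, $v$ such that for all $T\ge1$ and all data as above with $\delta<r$, the points played lie in $K$ almost surely, the rewards $f_t(X_t)$ are integrable, and $$\frac1e\max_{y\in K}\sum_{t=0}^{T-1}f_t(y)-\sum_{t=0}^{T-1}\mathbb E[f_t(X_t)]\le C(M_1+B_1)\,T^{2/3},$$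 $$\max_{0\le a\le b<T}\Big(\frac1e\max_{y\in K}\sum_{t=a}^{b}f_t(y)-\sum_{t=a}^{b}\mathbb E[f_t(X_t)]\Big)\le C(M_1+B_1)\,T^{2/3}.$$ That is, the expected $1/e$-static regret and the $1/e$-adaptive regret are $O(T^{2/3})$. -/

import Mathlib

open MeasureTheory ProbabilityTheory

noncomputable section

/-- The cube `[0,1]^d` in Euclidean space. -/
def unitCube (d : ℕ) : Set (EuclideanSpace ℝ (Fin d)) :=
  {x | ∀ i, 0 ≤ x i ∧ x i ≤ 1}

/-- A closed convex down-closed set `K ⊆ [0,1]^d` all of whose pairwise distances are at most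
`D`. -/
structure IsConstraintSet {d : ℕ} (K : Set (EuclideanSpace ℝ (Fin d))) (D : ℝ) : Prop where
  isClosed : IsClosed K
  convex : Convex ℝ K
  subset_cube : K ⊆ unitCube d
  down_closed : ∀ y ∈ K, ∀ x : EuclideanSpace ℝ (Fin d), (∀ i, 0 ≤ x i ∧ x i ≤ y i) → x ∈ K
  dist_le : ∀ x ∈ K, ∀ y ∈ K, ‖x - y‖ ≤ D

/-- The gradient of a function on the cube (one-sided at the boundary of the cube). -/
def cubeGrad {d : ℕ} (f : EuclideanSpace ℝ (Fin d) → ℝ) (x : EuclideanSpace ℝ (Fin d)) :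
    EuclideanSpace ℝ (Fin d) :=
  gradientWithin f (unitCube d) x

/-- Non-negative differentiable (not necessarily monotone) DR-submodular functions on the cube
that are `M₁`-Lipschitz and `Λ`-smooth on `K`. Values outside the cube play no role. -/
structure IsObjective {d : ℕ} (K : Set (EuclideanSpace ℝ (Fin d))) (M₁ Λ : ℝ)
    (f : EuclideanSpace ℝ (Fin d) → ℝ) : Prop where
  nonneg : ∀ x ∈ unitCube d, 0 ≤ f x
  differentiable : DifferentiableOn ℝ f (unitCube d)
  dr_submodular : ∀ x ∈ unitCube d, ∀ y ∈ unitCube d, (∀ i, x i ≤ y i) →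
    ∀ i, cubeGrad f y i ≤ cubeGrad f x i
  lipschitz : ∀ x ∈ K, ‖cubeGrad f x‖ ≤ M₁
  smooth : ∀ x ∈ K, ∀ y ∈ K, ‖cubeGrad f x - cubeGrad f y‖ ≤ Λ * ‖x - y‖

/-! ### Online gradient ascent via a separation oracle -/

/-- A separation oracle for `K`: at every point outside `K` it returns the normal of a
hyperplane that strictly separates the point from `K`. -/
def IsSeparationOracle {d : ℕ} (K : Set (EuclideanSpace ℝ (Fin d)))
    (SO : EuclideanSpace ℝ (Fin d) → EuclideanSpace ℝ (Fin d)) : Prop :=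
  ∀ y, y ∉ K → ∀ x ∈ K, 0 < inner ℝ (y - x) (SO y)

/-- Start of the infeasible projection: the point is projected to the affine hull of `K` (which
is `c + vectorSpan ℝ K` for `c ∈ K`), and then to the ball of radius `D` around `c`. -/
def soIPStart {d : ℕ} (K : Set (EuclideanSpace ℝ (Fin d))) (c : EuclideanSpace ℝ (Fin d))
    (D : ℝ) (y₀ : EuclideanSpace ℝ (Fin d)) : EuclideanSpace ℝ (Fin d) :=
  let y₁ := c + (vectorSpan ℝ K).starProjection (y₀ - c)
  c + (max 1 (‖y₁ - c‖ / D))⁻¹ • (y₁ - c)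

/-- One step of length `δ` along the (projected) separating direction, towards `K`. -/
def soIPStep {d : ℕ} (K : Set (EuclideanSpace ℝ (Fin d)))
    (SO : EuclideanSpace ℝ (Fin d) → EuclideanSpace ℝ (Fin d)) (δ : ℝ)
    (y : EuclideanSpace ℝ (Fin d)) : EuclideanSpace ℝ (Fin d) :=
  let g := (vectorSpan ℝ K).starProjection (SO y)
  y - (δ / ‖g‖) • g

open Classical in
/-- The infeasible projection: iterate the step until the first point in `K`, and return it.
(If `K` is never reached, the value is the starting point.) -/
def soIP {d : ℕ} (K : Set (EuclideanSpace ℝ (Fin d))) (c : EuclideanSpace ℝ (Fin d)) (D : ℝ)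
    (SO : EuclideanSpace ℝ (Fin d) → EuclideanSpace ℝ (Fin d)) (δ : ℝ)
    (y₀ : EuclideanSpace ℝ (Fin d)) : EuclideanSpace ℝ (Fin d) :=
  if h : ∃ n : ℕ, (soIPStep K SO δ)^[n] (soIPStart K c D y₀) ∈ K then
    (soIPStep K SO δ)^[Nat.find h] (soIPStart K c D y₀)
  else soIPStart K c D y₀

/-- One update of the online gradient ascent: a gradient step of size `η` from `x` along `g`,
followed by the infeasible projection. -/
def soOGAStep {d : ℕ} (K : Set (EuclideanSpace ℝ (Fin d))) (c : EuclideanSpace ℝ (Fin d))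
    (D : ℝ) (SO : EuclideanSpace ℝ (Fin d) → EuclideanSpace ℝ (Fin d)) (δ η : ℝ)
    (x g : EuclideanSpace ℝ (Fin d)) : EuclideanSpace ℝ (Fin d) :=
  soIP K c D SO δ (x + η • g)

/-! ### The query algorithm -/

/-- `h_z(x) = 1 - e^{-z x}`, coordinatewise. -/
def expMap {d : ℕ} (z : ℝ) (x : EuclideanSpace ℝ (Fin d)) : EuclideanSpace ℝ (Fin d) :=
  WithLp.toLp 2 fun i => 1 - Real.exp (-(z * x i))

/-- The law of the scalar `z`: density `e^{z-1} / (1 - e^{-1})` on `[0,1]`. -/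
def bqndLaw : Measure ℝ :=
  (volume.restrict (Set.Icc (0 : ℝ) 1)).withDensity
    fun z => ENNReal.ofReal (Real.exp (z - 1) / (1 - Real.exp (-1)))

/-- The estimator `v ⊙ e^{-z x}`, where `v` is the answer of the oracle to the query
`1 - e^{-z x}`. -/
def bqndEstimate {d : ℕ} (z : ℝ) (x v : EuclideanSpace ℝ (Fin d)) :
    EuclideanSpace ℝ (Fin d) :=
  WithLp.toLp 2 fun i => v i * Real.exp (-(z * x i))

/-! ### The blocking meta-algorithm

Rounds and blocks are numbered from `0`: block `q` consists of the rounds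
`q * L, …, q * L + L - 1`, so that round `t` lies in block `t / L`. -/

/-- Block size: `T^{1/3}`, rounded up. -/
def blockSize (T : ℕ) : ℕ := ⌈(T : ℝ) ^ (1 / 3 : ℝ)⌉₊

lemma blockSize_pos {T : ℕ} (hT : 1 ≤ T) : 0 < blockSize T := by
  have h : (0 : ℝ) < T := by exact_mod_cast hT
  exact Nat.ceil_pos.2 (Real.rpow_pos_of_pos h _)

/-- Number of blocks, which is the horizon of the base algorithm: `T / L`, rounded up. (The last
block is cut off after the last round.) -/
def numBlocks (T : ℕ) : ℕ := ⌈(T : ℝ) / blockSize T⌉₊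

/-- The round of block `q` in which the one query of this block is played: the first entry of
the permutation `π q` of the rounds of the block. -/
def queryRound {L : ℕ} (hL : 0 < L) (π : ℕ → Equiv.Perm (Fin L)) (q : ℕ) : ℕ :=
  q * L + (π q ⟨0, hL⟩ : Fin L)

/-- The iterates of the base learner, one per block, as a function of the scalars `z q`, of the
permutations `π q` and of the feedback `o t` of the rounds. The only feedback used in block `q`
is that of its query round. -/
def baseIterate {d : ℕ} (K : Set (EuclideanSpace ℝ (Fin d))) (c : EuclideanSpace ℝ (Fin d))
    (D : ℝ) (SO : EuclideanSpace ℝ (Fin d) → EuclideanSpace ℝ (Fin d)) (δ η : ℝ)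
    {L : ℕ} (hL : 0 < L) (z : ℕ → ℝ) (π : ℕ → Equiv.Perm (Fin L))
    (o : ℕ → EuclideanSpace ℝ (Fin d)) : ℕ → EuclideanSpace ℝ (Fin d)
  | 0 => c
  | q + 1 =>
    let x := baseIterate K c D SO δ η hL z π o q
    soOGAStep K c D SO δ η x (bqndEstimate (z q) x (o (queryRound hL π q)))

/-- The point played in round `t`, in block `q = t / L`: the query `1 - e^{-z_q x_q}` in the
query round of the block, and the action `1 - e^{-x_q}` in its other rounds. -/
def playedAction {d : ℕ} (K : Set (EuclideanSpace ℝ (Fin d))) (c : EuclideanSpace ℝ (Fin d))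
    (D : ℝ) (SO : EuclideanSpace ℝ (Fin d) → EuclideanSpace ℝ (Fin d)) (δ η : ℝ)
    {L : ℕ} (hL : 0 < L) (z : ℕ → ℝ) (π : ℕ → Equiv.Perm (Fin L))
    (o : ℕ → EuclideanSpace ℝ (Fin d)) (t : ℕ) : EuclideanSpace ℝ (Fin d) :=
  if t = queryRound hL π (t / L) then
    expMap (z (t / L)) (baseIterate K c D SO δ η hL z π o (t / L))
  else
    expMap 1 (baseIterate K c D SO δ η hL z π o (t / L))

/-! ### The interaction with the adversary -/

/-- What is known before block `q` starts: the scalars and permutations of the earlier blocks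
and the feedback of the earlier rounds. -/
@[reducible] def blockHistory {d L : ℕ} {Ω : Type*} (z : ℕ → Ω → ℝ) (π : ℕ → Ω → Equiv.Perm (Fin L))
    (o : ℕ → Ω → EuclideanSpace ℝ (Fin d)) (q : ℕ) : MeasurableSpace Ω :=
  (⨆ j : Fin q, MeasurableSpace.comap (z j) inferInstance) ⊔
  (⨆ j : Fin q, MeasurableSpace.comap (π j) ⊤) ⊔
  (⨆ t : Fin (q * L), MeasurableSpace.comap (o t) inferInstance)

/-- What is known when the point of round `t` has been played and before its feedback arrives:
the scalars and permutations of the blocks up to the current one and the feedback of the earlier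
rounds. -/
@[reducible] def roundHistory {d L : ℕ} {Ω : Type*} (z : ℕ → Ω → ℝ) (π : ℕ → Ω → Equiv.Perm (Fin L))
    (o : ℕ → Ω → EuclideanSpace ℝ (Fin d)) (t : ℕ) : MeasurableSpace Ω :=
  (⨆ j : Fin (t / L + 1), MeasurableSpace.comap (z j) inferInstance) ⊔
  (⨆ j : Fin (t / L + 1), MeasurableSpace.comap (π j) ⊤) ⊔
  (⨆ s : Fin t, MeasurableSpace.comap (o s) inferInstance)

/-- A run with horizon `T`, under semi-bandit feedback, of a player who plays `X t` in round `t`: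
in every block fresh random coins `z q` and `π q` are drawn, and the feedback `o t` of round `t`
is a conditionally unbiased estimate, bounded by `B₁`, of the gradient of `f t` at the very point
that is played. -/
structure IsSemiBanditRun {d L : ℕ} {Ω : Type*} [MeasurableSpace Ω] (P : Measure Ω) (T : ℕ)
    (B₁ : ℝ) (f : ℕ → EuclideanSpace ℝ (Fin d) → ℝ) (z : ℕ → Ω → ℝ)
    (π : ℕ → Ω → Equiv.Perm (Fin L)) (o : ℕ → Ω → EuclideanSpace ℝ (Fin d))
    (X : ℕ → Ω → EuclideanSpace ℝ (Fin d)) : Prop where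
  measurable_z : ∀ q, q * L < T → Measurable (z q)
  measurable_perm : ∀ q, q * L < T → ∀ p, MeasurableSet {ω | π q ω = p}
  measurable_feedback : ∀ t < T, Measurable (o t)
  law_z : ∀ q, q * L < T → Measure.map (z q) P = bqndLaw
  law_perm : ∀ q, q * L < T → ∀ p, P {ω | π q ω = p} = ((L.factorial : ℕ) : ENNReal)⁻¹
  indep_z : ∀ q, q * L < T →
    Indep (MeasurableSpace.comap (z q) inferInstance) (blockHistory z π o q) P
  indep_perm : ∀ q, q * L < T →
    Indep (MeasurableSpace.comap (π q) ⊤)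
      (blockHistory z π o q ⊔ MeasurableSpace.comap (z q) inferInstance) P
  unbiased : ∀ t < T, P[o t | roundHistory z π o t] =ᵐ[P] fun ω => cubeGrad (f t) (X t ω)
  bounded : ∀ t < T, ∀ᵐ ω ∂P, ‖o t ω‖ ≤ B₁

/-! ### Regret -/

/-- `α`-regret over a set `I` of rounds:
`α max_{y ∈ K} ∑_{t ∈ I} f_t(y) - ∑_{t ∈ I} 𝔼[f_t(x_t)]`. -/
def regretOn {d : ℕ} {Ω : Type*} [MeasurableSpace Ω] (P : Measure Ω) (α : ℝ)
    (K : Set (EuclideanSpace ℝ (Fin d))) (f : ℕ → EuclideanSpace ℝ (Fin d) → ℝ)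
    (X : ℕ → Ω → EuclideanSpace ℝ (Fin d)) (I : Finset ℕ) : ℝ :=
  α * sSup ((fun y => ∑ t ∈ I, f t y) '' K) - ∑ t ∈ I, ∫ ω, f t (X t ω) ∂P

/-- Static `α`-regret over the rounds `0, …, T - 1`. -/
def staticRegret {d : ℕ} {Ω : Type*} [MeasurableSpace Ω] (P : Measure Ω) (α : ℝ)
    (K : Set (EuclideanSpace ℝ (Fin d))) (f : ℕ → EuclideanSpace ℝ (Fin d) → ℝ)
    (X : ℕ → Ω → EuclideanSpace ℝ (Fin d)) (T : ℕ) : ℝ :=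
  regretOn P α K f X (Finset.range T)

/-- Adaptive `α`-regret: the largest regret over an interval of the rounds `0, …, T - 1`. -/
def adaptiveRegret {d : ℕ} {Ω : Type*} [MeasurableSpace Ω] (P : Measure Ω) (α : ℝ)
    (K : Set (EuclideanSpace ℝ (Fin d))) (f : ℕ → EuclideanSpace ℝ (Fin d) → ℝ)
    (X : ℕ → Ω → EuclideanSpace ℝ (Fin d)) (T : ℕ) : ℝ :=
  sSup {ρ | ∃ a b : ℕ, a ≤ b ∧ b < T ∧ ρ = regretOn P α K f X (Finset.Icc a b)}

end

/-! ### The infeasible projection -/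

section InfeasibleProjection

variable {d : ℕ} {K : Set (EuclideanSpace ℝ (Fin d))} {c : EuclideanSpace ℝ (Fin d)}
  {SO : EuclideanSpace ℝ (Fin d) → EuclideanSpace ℝ (Fin d)} {D δ r : ℝ}

/-! The problem reduces to online linear optimization with one linear round per block.

Boosting. Write h_z(x) = 1 - e^{-zx}. DR-submodularity and non-negativity give ⟨∇f(h_z(x)), y ⊙
e^{-zx}⟩ ≥ e^{-z} f(y) - f(h_z(x)) (`IsObjective.le_inner_bqndEstimate`), while x ⊙ e^{-zx} is the
velocity of z ↦ h_z(x). Subtracting, weighting by e^{z-1} and integrating over [0,1], the terms in x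
form the derivative of e^{z-1} f(h_z(x)). Hence f(y)/e - f(h_1(x)) is at most (1 - 1/e) times the
mean over z of ⟨∇f(h_z(x)) ⊙ e^{-zx}, y - x⟩ (`IsObjective.sub_le_integral_inner`).

Blocking. The query round is uniform in its block and independent of x_q and z_q, so L times the
expected linear gap of the single estimate controls the gaps of all L rounds
(`IsBlockingRun.sum_action_gap_le`). Playing the query instead of the action costs at most M₁D, once
per block.

Linear regret. An infeasible projection never moves away from a point whose δ-neighbourhood in
aff(K) lies in K (`norm_soIP_sub_le`). Gradient ascent therefore telescopes against y shrunk towards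
c by δ/r. The initial potential is at most D² at whichever block the sum starts, so the bound holds
on every interval of blocks, and this is what gives adaptive regret (`sum_inner_le_of_soOGAStep`).

Rates. With η and δ of order Q^{-1/2}, the linear regret is of order B₁√Q. The total L·B₁√Q + (Q +
L)·M₁ is of order T^{2/3}, since L is of order T^{1/3} and Q at most of order T^{2/3}; the L·M₁ pays
for the incomplete blocks at the two ends of an interval. -/

lemma sub_mem_vectorSpan {x y : EuclideanSpace ℝ (Fin d)} (hx : x ∈ K) (hy : y ∈ K) :
    x - y ∈ vectorSpan ℝ K := by
  simpa using vsub_mem_vectorSpan ℝ hx hy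

lemma soIPStart_sub_mem (y₀ : EuclideanSpace ℝ (Fin d)) :
    soIPStart K c D y₀ - c ∈ vectorSpan ℝ K := by
  simp only [soIPStart, add_sub_cancel_left]
  exact Submodule.smul_mem _ _ (Submodule.starProjection_apply_mem _ _)

/-- The separating direction is projected exactly so that the iterates never leave the affine hull
of `K`; margins are only available inside it. -/
lemma soIPStep_sub_mem {y : EuclideanSpace ℝ (Fin d)} (hy : y - c ∈ vectorSpan ℝ K) :
    soIPStep K SO δ y - c ∈ vectorSpan ℝ K := by
  simp only [soIPStep]
  rw [sub_right_comm]
  exact Submodule.sub_mem _ hy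
    (Submodule.smul_mem _ _ (Submodule.starProjection_apply_mem _ _))

lemma iterate_soIPStep_sub_mem {y : EuclideanSpace ℝ (Fin d)} (hy : y - c ∈ vectorSpan ℝ K)
    (n : ℕ) : (soIPStep K SO δ)^[n] y - c ∈ vectorSpan ℝ K := by
  induction n with
  | zero => simpa using hy
  | succ n ih =>
    rw [Function.iterate_succ_apply']
    exact soIPStep_sub_mem ih

/-- Radial projection to a ball does not increase the distance to the points of the ball. -/
lemma norm_radial_sub_le {E : Type*} [NormedAddCommGroup E] [InnerProductSpace ℝ E]
    (hD : 0 < D) (w : E) {u : E} (hu : ‖u‖ ≤ D) :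
    ‖(max 1 (‖w‖ / D))⁻¹ • w - u‖ ≤ ‖w - u‖ := by
  rcases le_total (‖w‖ / D) 1 with h | h
  · simp [max_eq_left h]
  · rw [max_eq_right h]
    set l := ‖w‖ / D with hl
    have hl0 : 0 < l := by linarith
    set p := l⁻¹ • w with hp
    have hw : w = l • p := by rw [hp, smul_inv_smul₀ hl0.ne']
    have hpn : ‖p‖ = D := by
      have h1 : ‖w‖ = l * D := by rw [hl]; field_simp
      rw [hp, norm_smul, norm_inv, Real.norm_of_nonneg hl0.le, h1]
      field_simp
    have h2 : inner ℝ p u ≤ D * D :=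
      (real_inner_le_norm p u).trans (by rw [hpn]; gcongr)
    have h3 : ‖w - u‖ ^ 2 = ‖p - u‖ ^ 2 + 2 * ((l - 1) * (D * D - inner ℝ p u))
        + ‖(l - 1) • p‖ ^ 2 := by
      have : w - u = (p - u) + (l - 1) • p := by rw [hw]; module
      rw [this, norm_add_sq_real, inner_smul_right, inner_sub_left, real_inner_self_eq_norm_mul_norm,
        hpn, real_inner_comm]
    have h4 : 0 ≤ (l - 1) * (D * D - inner ℝ p u) :=
      mul_nonneg (by linarith) (by linarith)
    refine le_of_sq_le_sq ?_ (norm_nonneg _)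
    nlinarith [sq_nonneg ‖(l - 1) • p‖]

lemma norm_soIPStart_sub_le (hD : 0 < D) (y₀ : EuclideanSpace ℝ (Fin d))
    {u : EuclideanSpace ℝ (Fin d)} (hu : u - c ∈ vectorSpan ℝ K) (huD : ‖u - c‖ ≤ D) :
    ‖soIPStart K c D y₀ - u‖ ≤ ‖y₀ - u‖ := by
  set w := (vectorSpan ℝ K).starProjection (y₀ - c) with hw
  have h1 : soIPStart K c D y₀ - u = (max 1 (‖w‖ / D))⁻¹ • w - (u - c) := by
    simp only [soIPStart, add_sub_cancel_left, ← hw]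
    abel
  rw [h1]
  refine (norm_radial_sub_le hD w huD).trans ?_
  have h2 : w - (u - c) = (vectorSpan ℝ K).starProjection (y₀ - u) := by
    rw [hw]
    nth_rw 1 [← Submodule.starProjection_eq_self_iff.2 hu]
    rw [← map_sub]
    congr 1
    abel
  rw [h2]
  exact Submodule.norm_starProjection_apply_le _ _

/-- If `y` lies outside `K`, a step moves it closer to every point that has a `δ`-margin. -/
lemma norm_soIPStep_sub_sq_le (hSO : IsSeparationOracle K SO) (hδ : 0 < δ)
    {y u : EuclideanSpace ℝ (Fin d)} (hyc : y - c ∈ vectorSpan ℝ K) (hc : c ∈ K) (hy : y ∉ K)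
    (hu : ∀ w ∈ vectorSpan ℝ K, ‖w‖ < δ → u + w ∈ K) :
    ‖soIPStep K SO δ y - u‖ ^ 2 ≤ ‖y - u‖ ^ 2 - δ ^ 2 := by
  set V := vectorSpan ℝ K with hV
  set g := V.starProjection (SO y) with hg
  have hgV : g ∈ V := Submodule.starProjection_apply_mem _ _
  have hinner : ∀ x ∈ K, 0 < inner ℝ (y - x) g := by
    intro x hx
    -- As `y - x` is parallel to the affine hull, projecting the oracle's answer does not change its
    -- inner product with `y - x`, so `g` still separates.
    have hm : y - x ∈ V := by
      have : y - x = (y - c) - (x - c) := by abel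
      rw [this]
      exact V.sub_mem hyc (sub_mem_vectorSpan hx hc)
    rw [hg, ← Submodule.inner_starProjection_left_eq_right,
      Submodule.starProjection_eq_self_iff.2 hm]
    exact hSO y hy x hx
  have hg0 : 0 < ‖g‖ := by
    rw [norm_pos_iff]
    rintro h
    have := hinner c hc
    simp [h] at this
  -- The margin is an open ball, so `u` is pushed along `g` by `a / ‖g‖ < δ`; separation from that
  -- point of `K` gives the bound with `a`, and `a` tends to `δ * ‖g‖`.
  have key : δ * ‖g‖ ≤ inner ℝ (y - u) g := by
    refine le_of_forall_lt_imp_le_of_dense fun a ha => ?_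
    rcases le_or_gt a 0 with h0 | h0
    · have := hinner u (by simpa using hu 0 V.zero_mem (by simpa using hδ))
      linarith
    · have h1 := hinner (u + (a / ‖g‖ ^ 2) • g) (hu _ (V.smul_mem _ hgV) (by
        rw [norm_smul, Real.norm_of_nonneg (by positivity), div_mul_eq_mul_div, sq,
          mul_div_mul_right _ _ hg0.ne', div_lt_iff₀ hg0]
        exact ha))
      have h2 : y - (u + (a / ‖g‖ ^ 2) • g) = (y - u) - (a / ‖g‖ ^ 2) • g := by abel
      rw [h2, inner_sub_left, inner_smul_left, real_inner_self_eq_norm_sq] at h1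
      simp only [RCLike.conj_to_real] at h1
      rw [div_mul_cancel₀ _ (by positivity)] at h1
      linarith
  have h3 : soIPStep K SO δ y - u = (y - u) - (δ / ‖g‖) • g := by
    simp only [soIPStep, ← hV, ← hg]
    abel
  have h4 : ‖(δ / ‖g‖) • g‖ = δ := by
    rw [norm_smul, Real.norm_of_nonneg (by positivity), div_mul_cancel₀ _ hg0.ne']
  have h5 : δ ^ 2 ≤ δ / ‖g‖ * inner ℝ (y - u) g := by
    rw [div_mul_eq_mul_div, le_div_iff₀ hg0]
    nlinarith
  rw [h3, norm_sub_sq_real, inner_smul_right, h4]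
  linarith

lemma margin_center (hball : Metric.ball c r ∩ (affineSpan ℝ K : Set (EuclideanSpace ℝ (Fin d))) ⊆ K)
    (hc : c ∈ K) : ∀ w ∈ vectorSpan ℝ K, ‖w‖ < r → c + w ∈ K := by
  intro w hw hwr
  refine hball ⟨by simpa [dist_eq_norm] using hwr, ?_⟩
  have := AffineSubspace.vadd_mem_of_mem_direction
    (by rwa [direction_affineSpan] : w ∈ (affineSpan ℝ K).direction) (mem_affineSpan ℝ hc)
  simpa [add_comm] using this

/-- The points of `K` moved towards `c` by the proportion `δ / r` have a `δ`-margin. -/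
lemma margin_shrink (hK : Convex ℝ K) (hδ : 0 < δ) (hδr : δ < r)
    (hcen : ∀ w ∈ vectorSpan ℝ K, ‖w‖ < r → c + w ∈ K) {y : EuclideanSpace ℝ (Fin d)}
    (hy : y ∈ K) : ∀ w ∈ vectorSpan ℝ K, ‖w‖ < δ →
      (y + (δ / r) • (c - y)) + w ∈ K := by
  intro w hw hwδ
  have hr : 0 < r := hδ.trans hδr
  have h1 := hcen ((r / δ) • w) (Submodule.smul_mem _ _ hw) (by
    rw [norm_smul, Real.norm_of_nonneg (by positivity), div_mul_eq_mul_div, div_lt_iff₀ hδ]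
    gcongr)
  -- `c + (r / δ) w` lies in `K`, and weighting it by `δ / r` against `y` brings the displacement
  -- back to `w`.
  have h2 := hK hy h1 (a := 1 - δ / r) (b := δ / r)
    (by rw [sub_nonneg, div_le_one hr]; exact hδr.le) (by positivity) (by ring)
  convert h2 using 1
  have h3 : (δ / r) • (r / δ) • w = w := by
    rw [smul_smul, div_mul_div_cancel₀ hr.ne', div_self hδ.ne', one_smul]
  rw [smul_add, h3]
  module

/-- The centre has margin `r > δ`, so every step outside `K` lowers the squared distance to `c` by
`δ ^ 2`, which cannot go on forever. -/
lemma exists_iterate_soIPStep_mem (hSO : IsSeparationOracle K SO) (hδ : 0 < δ) (hδr : δ < r)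
    (hc : c ∈ K) (hcen : ∀ w ∈ vectorSpan ℝ K, ‖w‖ < r → c + w ∈ K)
    {y : EuclideanSpace ℝ (Fin d)} (hy : y - c ∈ vectorSpan ℝ K) :
    ∃ n : ℕ, (soIPStep K SO δ)^[n] y ∈ K := by
  by_contra! hcon
  have hdec : ∀ n : ℕ, ‖(soIPStep K SO δ)^[n] y - c‖ ^ 2 ≤ ‖y - c‖ ^ 2 - n * δ ^ 2 := by
    intro n
    induction n with
    | zero => simp
    | succ n ih =>
      rw [Function.iterate_succ_apply']
      have := norm_soIPStep_sub_sq_le hSO hδ (iterate_soIPStep_sub_mem hy n) hc (hcon n)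
        (fun w hw hwδ => hcen w hw (hwδ.trans hδr))
      push_cast
      linarith
  obtain ⟨n, hn⟩ := exists_nat_gt (‖y - c‖ ^ 2 / δ ^ 2)
  rw [div_lt_iff₀ (by positivity)] at hn
  have := hdec n
  nlinarith [sq_nonneg ‖(soIPStep K SO δ)^[n] y - c‖]

lemma exists_iterate_soIPStart_mem (hSO : IsSeparationOracle K SO) (hδ : 0 < δ) (hδr : δ < r)
    (hc : c ∈ K) (hcen : ∀ w ∈ vectorSpan ℝ K, ‖w‖ < r → c + w ∈ K)
    (y₀ : EuclideanSpace ℝ (Fin d)) :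
    ∃ n : ℕ, (soIPStep K SO δ)^[n] (soIPStart K c D y₀) ∈ K :=
  exists_iterate_soIPStep_mem hSO hδ hδr hc hcen (soIPStart_sub_mem y₀)

lemma soIP_mem (hSO : IsSeparationOracle K SO) (hδ : 0 < δ) (hδr : δ < r)
    (hc : c ∈ K) (hcen : ∀ w ∈ vectorSpan ℝ K, ‖w‖ < r → c + w ∈ K)
    (y₀ : EuclideanSpace ℝ (Fin d)) : soIP K c D SO δ y₀ ∈ K := by
  classical
  have h := exists_iterate_soIPStart_mem (D := D) hSO hδ hδr hc hcen y₀
  rw [soIP, dif_pos h]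
  exact Nat.find_spec h

lemma norm_soIP_sub_le (hSO : IsSeparationOracle K SO) (hD : 0 < D) (hδ : 0 < δ) (hc : c ∈ K)
    (hdiam : ∀ x ∈ K, ‖x - c‖ ≤ D) {u : EuclideanSpace ℝ (Fin d)}
    (hu : ∀ w ∈ vectorSpan ℝ K, ‖w‖ < δ → u + w ∈ K) (y₀ : EuclideanSpace ℝ (Fin d)) :
    ‖soIP K c D SO δ y₀ - u‖ ≤ ‖y₀ - u‖ := by
  classical
  have huK : u ∈ K := by simpa using hu 0 (Submodule.zero_mem _) (by simpa using hδ)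
  have h0 := norm_soIPStart_sub_le hD y₀ (sub_mem_vectorSpan huK hc) (hdiam u huK)
  unfold soIP
  split_ifs with h
  · refine le_trans ?_ h0
    have : ∀ n ≤ Nat.find h, ‖(soIPStep K SO δ)^[n] (soIPStart K c D y₀) - u‖
        ≤ ‖soIPStart K c D y₀ - u‖ := by
      intro n
      induction n with
      | zero => simp
      | succ n ih =>
        intro hn
        refine le_trans ?_ (ih (by omega))
        rw [Function.iterate_succ_apply']
        refine le_of_sq_le_sq ?_ (norm_nonneg _)
        have := norm_soIPStep_sub_sq_le hSO hδ (iterate_soIPStep_sub_mem (soIPStart_sub_mem y₀) n)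
          hc (Nat.find_min h (by omega)) hu
        nlinarith [sq_nonneg δ]
    exact this _ le_rfl
  -- The default value is the starting point, which already satisfies the bound; termination is not
  -- needed here.
  · exact h0

/-- One-step inequality of online gradient ascent against a point with a `δ`-margin. -/
lemma two_mul_inner_le_of_soOGAStep (hSO : IsSeparationOracle K SO) (hD : 0 < D) (hδ : 0 < δ)
    (hc : c ∈ K) (hdiam : ∀ x ∈ K, ‖x - c‖ ≤ D) {u : EuclideanSpace ℝ (Fin d)}
    (hu : ∀ w ∈ vectorSpan ℝ K, ‖w‖ < δ → u + w ∈ K) (η : ℝ)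
    (x g : EuclideanSpace ℝ (Fin d)) :
    2 * η * inner ℝ g (u - x) ≤
      ‖x - u‖ ^ 2 - ‖soOGAStep K c D SO δ η x g - u‖ ^ 2 + η ^ 2 * ‖g‖ ^ 2 := by
  have h1 : ‖soOGAStep K c D SO δ η x g - u‖ ^ 2 ≤ ‖x + η • g - u‖ ^ 2 := by
    gcongr
    exact norm_soIP_sub_le hSO hD hδ hc hdiam hu _
  have h2 : x + η • g - u = η • g - (u - x) := by abel
  rw [h2, norm_sub_sq_real (η • g), inner_smul_left, norm_smul, mul_pow, Real.norm_eq_abs, sq_abs,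
    norm_sub_rev u x] at h1
  simp only [RCLike.conj_to_real] at h1
  linarith

lemma measurable_soIPStart : Measurable (soIPStart K c D) := by
  unfold soIPStart
  fun_prop

lemma measurable_soIPStep (hSO : Measurable SO) : Measurable (soIPStep K SO δ) := by
  unfold soIPStep
  fun_prop

lemma measurable_soIP (hK : IsClosed K) (hSO : IsSeparationOracle K SO) (hSOm : Measurable SO)
    (hδ : 0 < δ) (hδr : δ < r) (hc : c ∈ K)
    (hcen : ∀ w ∈ vectorSpan ℝ K, ‖w‖ < r → c + w ∈ K) : Measurable (soIP K c D SO δ) := by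
  classical
  have hm : ∀ n : ℕ, Measurable fun y => (soIPStep K SO δ)^[n] (soIPStart K c D y) := fun n =>
    ((measurable_soIPStep hSOm).iterate n).comp measurable_soIPStart
  have := Measurable.find hm (p := fun n y => (soIPStep K SO δ)^[n] (soIPStart K c D y) ∈ K)
    (fun n => hm n hK.measurableSet) (exists_iterate_soIPStart_mem hSO hδ hδr hc hcen)
  convert this using 2 with y
  rw [soIP, dif_pos (exists_iterate_soIPStart_mem hSO hδ hδr hc hcen y)]

end InfeasibleProjection

/-! ### DR-submodular functions on the cube -/

section Cube

variable {d : ℕ}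

lemma convex_unitCube : Convex ℝ (unitCube d) := by
  intro x hx y hy a b ha hb hab i
  simp only [PiLp.add_apply, PiLp.smul_apply, smul_eq_mul]
  constructor
  · have := mul_nonneg ha (hx i).1
    have := mul_nonneg hb (hy i).1
    linarith
  · have := mul_le_mul_of_nonneg_left (hx i).2 ha
    have := mul_le_mul_of_nonneg_left (hy i).2 hb
    linarith

/-- Multiplication by e^{-zx} is a diagonal, hence symmetric, operator; it can be moved from the
feedback to the comparison direction. -/
lemma inner_bqndEstimate_left (z : ℝ) (x v w : EuclideanSpace ℝ (Fin d)) :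
    inner ℝ (bqndEstimate z x v) w = inner ℝ v (bqndEstimate z x w) := by
  simp only [PiLp.inner_apply, bqndEstimate, RCLike.inner_apply, RCLike.conj_to_real]
  exact Finset.sum_congr rfl fun i _ => by ring

lemma norm_bqndEstimate_le {z : ℝ} (hz : 0 ≤ z) {x : EuclideanSpace ℝ (Fin d)}
    (hx : x ∈ unitCube d) (v : EuclideanSpace ℝ (Fin d)) : ‖bqndEstimate z x v‖ ≤ ‖v‖ := by
  rw [EuclideanSpace.norm_eq, EuclideanSpace.norm_eq]
  refine Real.sqrt_le_sqrt (Finset.sum_le_sum fun i _ => ?_)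
  simp only [bqndEstimate, norm_mul]
  have h1 : ‖Real.exp (-(z * x i))‖ ≤ 1 := by
    rw [Real.norm_of_nonneg (Real.exp_pos _).le, Real.exp_le_one_iff, neg_nonpos]
    exact mul_nonneg hz (hx i).1
  gcongr
  exact mul_le_of_le_one_right (norm_nonneg _) h1

/-- Since 1 - e^{-s} ≤ s, the point lies below `x`, and `K` is down-closed. Hence queries and
actions are feasible. -/
lemma expMap_mem {K : Set (EuclideanSpace ℝ (Fin d))} {D : ℝ} (hK : IsConstraintSet K D) {z : ℝ}
    (hz : z ∈ Set.Icc (0 : ℝ) 1) {x : EuclideanSpace ℝ (Fin d)} (hx : x ∈ K) :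
    expMap z x ∈ K := by
  refine hK.down_closed x hx _ fun i => ?_
  have hxi := hK.subset_cube hx i
  simp only [expMap]
  constructor
  · rw [sub_nonneg, Real.exp_le_one_iff, neg_nonpos]
    exact mul_nonneg hz.1 hxi.1
  · have h1 := Real.add_one_le_exp (-(z * x i))
    have h2 : z * x i ≤ x i := mul_le_of_le_one_left hxi.1 hz.2
    linarith

lemma continuous_expMap :
    Continuous fun p : ℝ × EuclideanSpace ℝ (Fin d) => expMap p.1 p.2 := by
  unfold expMap
  fun_prop

lemma continuous_bqndEstimate :
    Continuous fun p : ℝ × EuclideanSpace ℝ (Fin d) × EuclideanSpace ℝ (Fin d) =>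
      bqndEstimate p.1 p.2.1 p.2.2 := by
  unfold bqndEstimate
  fun_prop

/-- The velocity of the curve is x ⊙ e^{-zx}; this is why the estimator carries the factor e^{-zx}.
-/
lemma hasDerivAt_expMap (z : ℝ) (x : EuclideanSpace ℝ (Fin d)) :
    HasDerivAt (fun z => expMap z x) (bqndEstimate z x x) z := by
  rw [hasDerivAt_iff_hasFDerivAt, ← hasFDerivWithinAt_univ, hasFDerivWithinAt_euclidean]
  intro i
  have h : HasDerivAt (fun z : ℝ => 1 - Real.exp (-(z * x i)))
      (-(Real.exp (-(z * x i)) * (-(1 * x i)))) z :=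
    ((((hasDerivAt_id z).mul_const (x i)).neg).exp).const_sub 1
  refine h.hasFDerivAt.hasFDerivWithinAt.congr_fderiv ?_
  ext
  simp [bqndEstimate, mul_comm]

end Cube

/-! ### Concavity along non-negative directions and the boosted gradient. -/

section Objective

variable {d : ℕ} {K : Set (EuclideanSpace ℝ (Fin d))} {D M₁ Λ : ℝ}
  {f : EuclideanSpace ℝ (Fin d) → ℝ}

lemma IsObjective.hasFDerivWithinAt (hf : IsObjective K M₁ Λ f) {x : EuclideanSpace ℝ (Fin d)}
    (hx : x ∈ unitCube d) :
    HasFDerivWithinAt f (InnerProductSpace.toDual ℝ _ (cubeGrad f x)) (unitCube d) x :=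
  (hf.differentiable x hx).hasGradientWithinAt.hasFDerivWithinAt

/-- Along a non-negative direction the increment lies between the directional derivatives at the
two end points. -/
lemma IsObjective.inner_le_sub_le (hf : IsObjective K M₁ Λ f) {p w : EuclideanSpace ℝ (Fin d)}
    (hp : p ∈ unitCube d) (hpw : p + w ∈ unitCube d) (hw : ∀ i, 0 ≤ w i) :
    inner ℝ (cubeGrad f (p + w)) w ≤ f (p + w) - f p ∧
      f (p + w) - f p ≤ inner ℝ (cubeGrad f p) w := by
  have hmem : ∀ s ∈ Set.Icc (0 : ℝ) 1, p + s • w ∈ unitCube d := fun s hs => by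
    convert convex_unitCube hp hpw (sub_nonneg.2 hs.2) hs.1 (by ring) using 1
    module
  have hder : ∀ s ∈ Set.Icc (0 : ℝ) 1, HasDerivWithinAt (fun s : ℝ => f (p + s • w))
      (inner ℝ (cubeGrad f (p + s • w)) w) (Set.Icc 0 1) s := by
    intro s hs
    have h1 : HasDerivWithinAt (fun s : ℝ => p + s • w) w (Set.Icc 0 1) s := by
      simpa using (((hasDerivAt_id s).smul_const w).const_add p).hasDerivWithinAt
    simpa [Function.comp_def] using (hf.hasFDerivWithinAt (hmem s hs)).comp_hasDerivWithinAt s h1 hmem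
  obtain ⟨s, hs, heq⟩ := exists_hasDerivAt_eq_slope (fun s : ℝ => f (p + s • w))
    (fun s => inner ℝ (cubeGrad f (p + s • w)) w) zero_lt_one
    (fun s hs => (hder s hs).continuousWithinAt)
    (fun s hs => (hder s (Set.Ioo_subset_Icc_self hs)).hasDerivAt (Icc_mem_nhds hs.1 hs.2))
  have heq' : f (p + w) - f p = inner ℝ (cubeGrad f (p + s • w)) w := by
    simpa using heq.symm
  have hsm := hmem s (Set.Ioo_subset_Icc_self hs)
  rw [heq']
  simp only [PiLp.inner_apply, RCLike.inner_apply, RCLike.conj_to_real]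
  constructor
  · refine Finset.sum_le_sum fun i _ => mul_le_mul_of_nonneg_left ?_ (hw i)
    refine hf.dr_submodular _ hsm _ hpw (fun j => ?_) i
    simp only [PiLp.add_apply, PiLp.smul_apply, smul_eq_mul]
    have := mul_le_of_le_one_left (hw j) hs.2.le
    linarith
  · refine Finset.sum_le_sum fun i _ => mul_le_mul_of_nonneg_left ?_ (hw i)
    refine hf.dr_submodular _ hp _ hsm (fun j => ?_) i
    simp only [PiLp.add_apply, PiLp.smul_apply, smul_eq_mul]
    have := mul_nonneg hs.1.le (hw j)
    linarith

/-- Moving up from `y` towards the all-ones vector by a proportion of at most `θ` in every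
coordinate loses at most the factor `1 - θ`. -/
lemma IsObjective.one_sub_mul_le (hf : IsObjective K M₁ Λ f) {y u : EuclideanSpace ℝ (Fin d)}
    {θ : ℝ} (hθ0 : 0 ≤ θ) (hθ1 : θ ≤ 1) (hy : y ∈ unitCube d) (hu0 : ∀ i, 0 ≤ u i)
    (hu : ∀ i, u i ≤ θ * (1 - y i)) : (1 - θ) * f y ≤ f (y + u) := by
  have hyu : y + u ∈ unitCube d := fun i => by
    simp only [PiLp.add_apply]
    have h1 := hu i
    have h2 := mul_le_of_le_one_left (sub_nonneg.2 (hy i).2) hθ1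
    exact ⟨add_nonneg (hy i).1 (hu0 i), by linarith⟩
  rcases hθ0.eq_or_lt with rfl | hθ
  · have : u = 0 := by
      ext i
      have h1 := hu i
      have h2 := hu0 i
      rw [zero_mul] at h1
      exact le_antisymm h1 h2
    simp [this]
  · have hinv : 0 ≤ 1 / θ - 1 := by
      rw [sub_nonneg, le_div_iff₀ hθ]
      linarith
    -- The segment from `y` to `y + u` is prolonged by the factor `1 / θ`, which stays in the cube.
    -- The derivative at `y + u` compares the two slopes, and non-negativity at the far end does the
    -- rest.
    have heq : y + u + (1 / θ - 1) • u = y + (1 / θ) • u := by module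
    have hy2 : y + u + (1 / θ - 1) • u ∈ unitCube d := by
      rw [heq]
      intro i
      simp only [PiLp.add_apply, PiLp.smul_apply, smul_eq_mul]
      have h1 : 1 / θ * u i ≤ 1 - y i := by
        rw [div_mul_eq_mul_div, one_mul, div_le_iff₀ hθ]
        linarith [hu i]
      have h2 : 0 ≤ 1 / θ * u i := mul_nonneg (by positivity) (hu0 i)
      exact ⟨add_nonneg (hy i).1 h2, by linarith⟩
    have h1 := (hf.inner_le_sub_le hy hyu hu0).1
    have h2 := (hf.inner_le_sub_le hyu hy2 fun i => mul_nonneg hinv (hu0 i)).2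
    rw [inner_smul_right] at h2
    have h3 := hf.nonneg _ hy2
    have h4 := mul_le_mul_of_nonneg_left h1 hinv
    have h5 : θ * (f (y + u + (1 / θ - 1) • u) - f (y + u)) ≤ (1 - θ) * (f (y + u) - f y) := by
      have h6 := mul_le_mul_of_nonneg_left (h2.trans h4) hθ.le
      have h7 : θ * ((1 / θ - 1) * (f (y + u) - f y)) = (1 - θ) * (f (y + u) - f y) := by
        field_simp
      linarith
    nlinarith [mul_nonneg hθ.le h3]

/-- By concavity the right side is at least the increment of `f` from h_z(x) to h_z(x) + y ⊙
e^{-zx}. The latter point equals y + (1 - e^{-zx}) ⊙ (1 - y), an upward move by a proportion of at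
most 1 - e^{-z}, so it keeps the share e^{-z} of `f y`. -/
lemma IsObjective.le_inner_bqndEstimate (hf : IsObjective K M₁ Λ f)
    {x y : EuclideanSpace ℝ (Fin d)} (hx : x ∈ unitCube d) (hy : y ∈ unitCube d) {z : ℝ}
    (hz : 0 ≤ z) :
    Real.exp (-z) * f y - f (expMap z x) ≤
      inner ℝ (cubeGrad f (expMap z x)) (bqndEstimate z x y) := by
  have he : ∀ i, Real.exp (-z) ≤ Real.exp (-(z * x i)) ∧ Real.exp (-(z * x i)) ≤ 1 := fun i =>
    ⟨Real.exp_le_exp.2 (neg_le_neg (mul_le_of_le_one_right hz (hx i).2)),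
      Real.exp_le_one_iff.2 (neg_nonpos.2 (mul_nonneg hz (hx i).1))⟩
  have hcube : expMap z x ∈ unitCube d := fun i => by
    simp only [expMap]
    have := he i
    have := Real.exp_pos (-(z * x i))
    exact ⟨by linarith, by linarith⟩
  set u : EuclideanSpace ℝ (Fin d) :=
    WithLp.toLp 2 fun i => (1 - Real.exp (-(z * x i))) * (1 - y i) with hu
  have hsum : expMap z x + bqndEstimate z x y = y + u := by
    ext i
    simp only [expMap, bqndEstimate, hu, PiLp.add_apply]
    ring
  have h1 := hf.one_sub_mul_le (u := u) (θ := 1 - Real.exp (-z))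
    (by rw [sub_nonneg, Real.exp_le_one_iff]; linarith) (by linarith [Real.exp_pos (-z)]) hy
    (fun i => mul_nonneg (by linarith [he i]) (by linarith [hy i]))
    (fun i => mul_le_mul_of_nonneg_right (by linarith [he i]) (by linarith [hy i]))
  have hmem : expMap z x + bqndEstimate z x y ∈ unitCube d := by
    intro i
    simp only [expMap, bqndEstimate, PiLp.add_apply]
    have h2 := mul_nonneg (hy i).1 (Real.exp_pos (-(z * x i))).le
    have h3 := mul_le_of_le_one_left (Real.exp_pos (-(z * x i))).le (hy i).2
    exact ⟨by linarith [he i], by linarith⟩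
  have h2 := (hf.inner_le_sub_le hcube hmem
    fun i => mul_nonneg (hy i).1 (Real.exp_pos (-(z * x i))).le).2
  rw [hsum] at h2
  rw [sub_sub_cancel] at h1
  linarith

lemma IsObjective.continuousOn_cubeGrad (hf : IsObjective K M₁ Λ f) :
    ContinuousOn (cubeGrad f) K := by
  refine (LipschitzOnWith.of_dist_le_mul (K := Λ.toNNReal) fun x hx y hy => ?_).continuousOn
  rw [dist_eq_norm, dist_eq_norm]
  refine (hf.smooth x hx y hy).trans ?_
  gcongr
  exact Real.le_coe_toNNReal Λ

lemma IsObjective.continuousOn (hf : IsObjective K M₁ Λ f) (hK : K ⊆ unitCube d) :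
    ContinuousOn f K :=
  hf.differentiable.continuousOn.mono hK

lemma IsObjective.sub_le (hf : IsObjective K M₁ Λ f) (hK : IsConstraintSet K D)
    {x y : EuclideanSpace ℝ (Fin d)} (hx : x ∈ K) (hy : y ∈ K) :
    f y - f x ≤ M₁ * D := by
  have h1 := hK.convex.norm_image_sub_le_of_norm_hasFDerivWithin_le (C := M₁)
    (fun w hw => (hf.hasFDerivWithinAt (hK.subset_cube hw)).mono hK.subset_cube)
    (fun w hw => by simpa using hf.lipschitz w hw) hx hy
  have hM : 0 ≤ M₁ := (norm_nonneg _).trans (hf.lipschitz x hx)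
  exact (le_abs_self _).trans (h1.trans (mul_le_mul_of_nonneg_left (hK.dist_le y hy x hx) hM))

lemma integral_bqndLaw (φ : ℝ → ℝ) :
    ∫ z, φ z ∂bqndLaw =
      (1 - Real.exp (-1))⁻¹ * ∫ z in (0 : ℝ)..1, Real.exp (z - 1) * φ z := by
  rw [bqndLaw, integral_withDensity_eq_integral_toReal_smul (by fun_prop) (by simp),
    intervalIntegral.integral_of_le zero_le_one, ← integral_Icc_eq_integral_Ioc,
    ← integral_const_mul]
  refine integral_congr_ae (ae_of_all _ fun z => ?_)
  have : 0 < 1 - Real.exp (-1) := by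
    rw [sub_pos, Real.exp_lt_one_iff]
    norm_num
  simp only [smul_eq_mul]
  rw [ENNReal.toReal_ofReal (by positivity)]
  ring

lemma ae_bqndLaw_mem : ∀ᵐ z ∂bqndLaw, z ∈ Set.Icc (0 : ℝ) 1 :=
  (withDensity_absolutelyContinuous _ _).ae_le (ae_restrict_mem measurableSet_Icc)

/-- The estimator is, in expectation over `z`, an ascent direction that linearizes the objective
up to the factor `1 / e`. -/
lemma IsObjective.sub_le_integral_inner (hf : IsObjective K M₁ Λ f) (hK : IsConstraintSet K D)
    {x y : EuclideanSpace ℝ (Fin d)} (hx : x ∈ K) (hy : y ∈ K) :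
    Real.exp (-1) * f y - f (expMap 1 x) ≤ (1 - Real.exp (-1)) *
      ∫ z, inner ℝ (cubeGrad f (expMap z x)) (bqndEstimate z x (y - x)) ∂bqndLaw := by
  have hpos : 0 < 1 - Real.exp (-1) := by
    rw [sub_pos, Real.exp_lt_one_iff]
    norm_num
  rw [integral_bqndLaw, mul_inv_cancel_left₀ hpos.ne']
  have hxc := hK.subset_cube hx
  have hexp : Continuous fun z => expMap z x :=
    continuous_expMap.comp (continuous_id.prodMk continuous_const)
  have hest : ∀ v, Continuous fun z => bqndEstimate z x v := fun v =>
    continuous_bqndEstimate.comp (continuous_id.prodMk (continuous_const (y := (x, v))))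
  have hgrad : ContinuousOn (fun z => cubeGrad f (expMap z x)) (Set.Icc 0 1) :=
    hf.continuousOn_cubeGrad.comp hexp.continuousOn fun z hz => expMap_mem hK hz hx
  have hin : ∀ v, ContinuousOn
      (fun z => inner ℝ (cubeGrad f (expMap z x)) (bqndEstimate z x v)) (Set.Icc 0 1) := fun v =>
    hgrad.inner (hest v).continuousOn
  have hfc : ContinuousOn (fun z => f (expMap z x)) (Set.Icc 0 1) :=
    (hf.continuousOn hK.subset_cube).comp hexp.continuousOn fun z hz => expMap_mem hK hz hx
  have he : Continuous fun z : ℝ => Real.exp (z - 1) := by fun_prop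
  -- The weight e^{z-1} is its own derivative, so `G'` collects all the terms in `x`; it also turns
  -- e^{-z} f(y) into the constant e^{-1} f(y).
  set G : ℝ → ℝ := fun z => Real.exp (z - 1) * f (expMap z x) with hG
  set G' : ℝ → ℝ := fun z => Real.exp (z - 1) * f (expMap z x) +
    Real.exp (z - 1) * inner ℝ (cubeGrad f (expMap z x)) (bqndEstimate z x x) with hG'
  have hG'c : ContinuousOn G' (Set.Icc 0 1) :=
    (he.continuousOn.mul hfc).add (he.continuousOn.mul (hin x))
  have hG'i : IntervalIntegrable G' volume 0 1 :=
    (hG'c.mono (by rw [Set.uIcc_of_le zero_le_one])).intervalIntegrable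
  have hint : IntervalIntegrable (fun z => Real.exp (z - 1) *
      inner ℝ (cubeGrad f (expMap z x)) (bqndEstimate z x (y - x))) volume 0 1 :=
    ((he.continuousOn.mul (hin (y - x))).mono
      (by rw [Set.uIcc_of_le zero_le_one])).intervalIntegrable
  have hftc : ∫ z in (0 : ℝ)..1, G' z = G 1 - G 0 := by
    refine intervalIntegral.integral_eq_sub_of_hasDerivAt_of_le zero_le_one
      (he.continuousOn.mul hfc) (fun z hz => ?_) hG'i
    have h1 : HasDerivAt (fun z : ℝ => Real.exp (z - 1)) (Real.exp (z - 1)) z := by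
      simpa using ((hasDerivAt_id z).sub_const 1).exp
    have h2 : HasDerivAt (fun z => f (expMap z x))
        (inner ℝ (cubeGrad f (expMap z x)) (bqndEstimate z x x)) z := by
      have h3 := (hf.hasFDerivWithinAt (hK.subset_cube (expMap_mem hK
        (Set.Ioo_subset_Icc_self hz) hx))).comp_hasDerivWithinAt z
        (hasDerivAt_expMap z x).hasDerivWithinAt
        (fun z hz => hK.subset_cube (expMap_mem hK hz hx))
      simpa [Function.comp_def] using h3.hasDerivAt (Icc_mem_nhds hz.1 hz.2)
    exact h1.mul h2
  have hmono : ∫ z in (0 : ℝ)..1, (Real.exp (-1) * f y - G' z) ≤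
      ∫ z in (0 : ℝ)..1, Real.exp (z - 1) *
        inner ℝ (cubeGrad f (expMap z x)) (bqndEstimate z x (y - x)) := by
    refine intervalIntegral.integral_mono_on zero_le_one
      (intervalIntegrable_const.sub hG'i) hint fun z hz => ?_
    have h1 := hf.le_inner_bqndEstimate hxc (hK.subset_cube hy) hz.1
    have h2 : bqndEstimate z x (y - x) = bqndEstimate z x y - bqndEstimate z x x := by
      ext i
      simp only [bqndEstimate, PiLp.sub_apply]
      ring
    have h3 := mul_le_mul_of_nonneg_left h1 (Real.exp_pos (z - 1)).le
    have h4 : Real.exp (z - 1) * (Real.exp (-z) * f y) = Real.exp (-1) * f y := by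
      rw [← mul_assoc, ← Real.exp_add]
      ring_nf
    rw [h2, inner_sub_right]
    simp only [hG']
    linarith
  rw [intervalIntegral.integral_sub intervalIntegrable_const hG'i, hftc] at hmono
  -- Non-negativity of `f` allows the boundary term at `z = 0` to be dropped.
  have h0 : 0 ≤ G 0 := mul_nonneg (Real.exp_pos _).le
    (hf.nonneg _ (hK.subset_cube (expMap_mem hK ⟨le_rfl, zero_le_one⟩ hx)))
  have h1 : G 1 = f (expMap 1 x) := by simp [hG]
  rw [h1] at hmono
  simp only [intervalIntegral.integral_const, sub_zero, one_smul] at hmono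
  linarith

end Objective

/-! ### Measurability of the iterates -/

section Measurability

variable {d L : ℕ} {Ω : Type*} {K : Set (EuclideanSpace ℝ (Fin d))}
  {c : EuclideanSpace ℝ (Fin d)} {SO : EuclideanSpace ℝ (Fin d) → EuclideanSpace ℝ (Fin d)}
  {D δ η r : ℝ}

lemma baseIterate_mem (hSO : IsSeparationOracle K SO) (hδ : 0 < δ) (hδr : δ < r)
    (hc : c ∈ K) (hcen : ∀ w ∈ vectorSpan ℝ K, ‖w‖ < r → c + w ∈ K) (hL : 0 < L)
    (z : ℕ → ℝ) (π : ℕ → Equiv.Perm (Fin L)) (o : ℕ → EuclideanSpace ℝ (Fin d)) (q : ℕ) :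
    baseIterate K c D SO δ η hL z π o q ∈ K := by
  cases q with
  | zero => exact hc
  | succ q => exact soIP_mem hSO hδ hδr hc hcen _

/-- For reading the feedback at the random query round, which takes finitely many values. -/
lemma Measurable.finite_choice {ι E : Type*} [Finite ι] {m : MeasurableSpace Ω}
    [MeasurableSpace E] {F : ι → Ω → E} (hF : ∀ i, Measurable (F i)) {N : Ω → ι}
    (hN : ∀ i, MeasurableSet {ω | N ω = i}) : Measurable fun ω => F (N ω) ω := by
  intro S hS
  have : (fun ω => F (N ω) ω) ⁻¹' S = ⋃ i, {ω | N ω = i} ∩ F i ⁻¹' S := by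
    ext ω
    simp
  rw [this]
  exact MeasurableSet.iUnion fun i => (hN i).inter (hF i hS)

variable {z : ℕ → Ω → ℝ} {π : ℕ → Ω → Equiv.Perm (Fin L)}
  {o : ℕ → Ω → EuclideanSpace ℝ (Fin d)}

lemma comap_coin_le_blockHistory {j q : ℕ} (hj : j < q) :
    MeasurableSpace.comap (z j) inferInstance ≤ blockHistory z π o q :=
  le_sup_of_le_left (le_sup_of_le_left
    (le_iSup (fun j : Fin q => MeasurableSpace.comap (z j) inferInstance) ⟨j, hj⟩))

lemma comap_perm_le_blockHistory {j q : ℕ} (hj : j < q) :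
    MeasurableSpace.comap (π j) ⊤ ≤ blockHistory z π o q :=
  le_sup_of_le_left (le_sup_of_le_right
    (le_iSup (fun j : Fin q => MeasurableSpace.comap (π j) ⊤) ⟨j, hj⟩))

lemma comap_feedback_le_blockHistory {t q : ℕ} (ht : t < q * L) :
    MeasurableSpace.comap (o t) inferInstance ≤ blockHistory z π o q :=
  le_sup_of_le_right
    (le_iSup (fun j : Fin (q * L) => MeasurableSpace.comap (o j) inferInstance) ⟨t, ht⟩)

lemma blockHistory_le {m : MeasurableSpace Ω} {q : ℕ}
    (hz : ∀ j < q, MeasurableSpace.comap (z j) inferInstance ≤ m)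
    (hπ : ∀ j < q, MeasurableSpace.comap (π j) ⊤ ≤ m)
    (ho : ∀ t < q * L, MeasurableSpace.comap (o t) inferInstance ≤ m) :
    blockHistory z π o q ≤ m :=
  sup_le (sup_le (iSup_le fun j => hz j j.2) (iSup_le fun j => hπ j j.2))
    (iSup_le fun t => ho t t.2)

lemma blockHistory_mono {q q' : ℕ} (h : q ≤ q') :
    blockHistory z π o q ≤ blockHistory z π o q' :=
  blockHistory_le (fun _ hj => comap_coin_le_blockHistory (hj.trans_le h))
    (fun _ hj => comap_perm_le_blockHistory (hj.trans_le h))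
    (fun _ ht => comap_feedback_le_blockHistory (ht.trans_le (Nat.mul_le_mul_right L h)))

lemma comap_coin_le_roundHistory (t : ℕ) :
    MeasurableSpace.comap (z (t / L)) inferInstance ≤ roundHistory z π o t :=
  le_sup_of_le_left (le_sup_of_le_left (le_iSup
    (fun j : Fin (t / L + 1) => MeasurableSpace.comap (z j) inferInstance)
    ⟨t / L, Nat.lt_succ_self _⟩))

lemma comap_perm_le_roundHistory (t : ℕ) :
    MeasurableSpace.comap (π (t / L)) ⊤ ≤ roundHistory z π o t :=
  le_sup_of_le_left (le_sup_of_le_right (le_iSup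
    (fun j : Fin (t / L + 1) => MeasurableSpace.comap (π j) ⊤) ⟨t / L, Nat.lt_succ_self _⟩))

lemma blockHistory_le_roundHistory (t : ℕ) :
    blockHistory z π o (t / L) ≤ roundHistory z π o t :=
  blockHistory_le
    (fun j hj => le_sup_of_le_left (le_sup_of_le_left (le_iSup
      (fun j : Fin (t / L + 1) => MeasurableSpace.comap (z j) inferInstance) ⟨j, by omega⟩)))
    (fun j hj => le_sup_of_le_left (le_sup_of_le_right (le_iSup
      (fun j : Fin (t / L + 1) => MeasurableSpace.comap (π j) ⊤) ⟨j, by omega⟩)))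
    (fun s hs => le_sup_of_le_right (le_iSup
      (fun j : Fin t => MeasurableSpace.comap (o j) inferInstance)
      ⟨s, hs.trans_le (Nat.div_mul_le_self t L)⟩))

/-- The iterate of block `q` is determined by what is known before block `q` starts. -/
lemma measurable_baseIterate (hK : IsClosed K) (hSO : IsSeparationOracle K SO)
    (hSOm : Measurable SO) (hδ : 0 < δ) (hδr : δ < r) (hc : c ∈ K)
    (hcen : ∀ w ∈ vectorSpan ℝ K, ‖w‖ < r → c + w ∈ K) (hL : 0 < L) (q : ℕ) :
    Measurable[blockHistory z π o q] fun ω => baseIterate K c D SO δ η hL (fun q => z q ω)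
      (fun q => π q ω) (fun s => o s ω) q := by
  induction q with
  | zero => exact @measurable_const _ _ _ (blockHistory z π o 0) c
  | succ q ih =>
    -- From here on, measurability on `Ω` refers to the history before block `q + 1`, which contains
    -- the coins and all the feedback of block `q`.
    let _ : MeasurableSpace Ω := blockHistory z π o (q + 1)
    have hx := ih.mono (blockHistory_mono q.le_succ) le_rfl
    have hz : Measurable (z q) :=
      (comap_measurable (z q)).mono (comap_coin_le_blockHistory q.lt_succ_self) le_rfl
    have ho : Measurable fun ω => o (queryRound hL (fun q => π q ω) q) ω := by
      refine Measurable.finite_choice (F := fun p : Fin L => o (q * L + p))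
        (N := fun ω => π q ω ⟨0, hL⟩) (fun p => ?_) (fun p => ?_)
      · refine (comap_measurable _).mono (comap_feedback_le_blockHistory ?_) le_rfl
        have := p.2
        rw [Nat.succ_mul]
        omega
      · exact comap_perm_le_blockHistory q.lt_succ_self _
          ⟨{σ | σ ⟨0, hL⟩ = p}, trivial, rfl⟩
    have hb := continuous_bqndEstimate.measurable.comp (hz.prodMk (hx.prodMk ho))
    exact (measurable_soIP hK hSO hSOm hδ hδr hc hcen).comp (hx.add (hb.const_smul η))

end Measurability

/-! ### The histories as sub-σ-algebras of the ambient one. -/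

section Histories

variable {d L : ℕ} {Ω : Type*} {mΩ : MeasurableSpace Ω} {P : Measure Ω} {T : ℕ} {B₁ : ℝ}
  {f : ℕ → EuclideanSpace ℝ (Fin d) → ℝ} {z : ℕ → Ω → ℝ}
  {π : ℕ → Ω → Equiv.Perm (Fin L)} {o X : ℕ → Ω → EuclideanSpace ℝ (Fin d)}

lemma comap_perm_le {q : ℕ} (h : ∀ p, MeasurableSet {ω | π q ω = p}) :
    MeasurableSpace.comap (π q) ⊤ ≤ mΩ := by
  rintro _ ⟨S, -, rfl⟩
  have : π q ⁻¹' S = ⋃ p ∈ S, {ω | π q ω = p} := by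
    ext ω
    simp
  rw [this]
  exact MeasurableSet.biUnion (Set.to_countable S) fun p _ => h p

lemma IsSemiBanditRun.blockHistory_le (hrun : IsSemiBanditRun P T B₁ f z π o X) {q : ℕ}
    (hL : 0 < L) (hq : q * L ≤ T) : blockHistory z π o q ≤ mΩ :=
  _root_.blockHistory_le
    (fun j hj => (hrun.measurable_z j
      ((Nat.mul_lt_mul_of_pos_right hj hL).trans_le hq)).comap_le)
    (fun j hj => comap_perm_le (hrun.measurable_perm j
      ((Nat.mul_lt_mul_of_pos_right hj hL).trans_le hq)))
    (fun t ht => (hrun.measurable_feedback t (ht.trans_le hq)).comap_le)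

lemma IsSemiBanditRun.roundHistory_le (hrun : IsSemiBanditRun P T B₁ f z π o X) {t : ℕ}
    (ht : t < T) : roundHistory z π o t ≤ mΩ := by
  have hj : ∀ j : Fin (t / L + 1), j * L < T := fun j =>
    ((Nat.mul_le_mul_right L (Nat.lt_succ_iff.1 j.2)).trans (Nat.div_mul_le_self t L)).trans_lt ht
  exact sup_le (sup_le (iSup_le fun j => (hrun.measurable_z j (hj j)).comap_le)
    (iSup_le fun j => comap_perm_le (hrun.measurable_perm j (hj j))))
    (iSup_le fun s => (hrun.measurable_feedback s (s.2.trans ht)).comap_le)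

end Histories

/-! ### Conditional expectation of the estimator -/

section Probability

variable {d : ℕ} {Ω : Type*} {mΩ : MeasurableSpace Ω} {P : Measure Ω}

/-- The integral of a function of two independent variables is an iterated integral. -/
lemma integral_indep_pair [IsProbabilityMeasure P] {E : Type*} [MeasurableSpace E]
    {x : Ω → E} {Z : Ω → ℝ} (hx : Measurable x) (hZ : Measurable Z)
    (hind : IndepFun x Z P) {g : E × ℝ → ℝ} (hg : Measurable g) {C : ℝ}
    (hgC : ∀ p, ‖g p‖ ≤ C) :
    Integrable (fun ω => ∫ s, g (x ω, s) ∂(P.map Z)) P ∧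
    ∫ ω, g (x ω, Z ω) ∂P = ∫ ω, ∫ s, g (x ω, s) ∂(P.map Z) ∂P := by
  have := Measure.isProbabilityMeasure_map (μ := P) hx.aemeasurable
  have := Measure.isProbabilityMeasure_map (μ := P) hZ.aemeasurable
  have hint : Integrable g ((P.map x).prod (P.map Z)) :=
    Integrable.of_bound hg.aestronglyMeasurable C (ae_of_all _ hgC)
  have h1 := hint.integral_prod_left
  refine ⟨h1.comp_measurable hx, ?_⟩
  rw [← integral_map (f := g) (hx.prodMk hZ).aemeasurable hg.aestronglyMeasurable,
    hind.map_prod_eq_prod_map_map hx.aemeasurable hZ.aemeasurable, integral_prod _ hint,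
    integral_map hx.aemeasurable h1.aestronglyMeasurable]

lemma setIntegral_indep [IsProbabilityMeasure P] {m₁ m₂ : MeasurableSpace Ω} (hm₁ : m₁ ≤ mΩ)
    (hm₂ : m₂ ≤ mΩ) (hind : Indep m₁ m₂ P) {φ : Ω → ℝ} (hφ : StronglyMeasurable[m₁] φ)
    (hφi : Integrable φ P) {A : Set Ω} (hA : MeasurableSet[m₂] A) :
    ∫ ω in A, φ ω ∂P = P.real A * ∫ ω, φ ω ∂P := by
  rw [← setIntegral_condExp hm₂ hφi hA, setIntegral_congr_ae (hm₂ _ hA)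
    ((condExp_indep_eq hm₁ hm₂ hφ hind).mono fun _ h _ => h)]
  simp

/-- `W` is known given `m`, so it can be pulled out of the conditional expectation; this is where
unbiasedness of the feedback enters. -/
lemma setIntegral_inner_condExp [IsProbabilityMeasure P] {m : MeasurableSpace Ω} (hm : m ≤ mΩ)
    {o W : Ω → EuclideanSpace ℝ (Fin d)} (ho : Integrable o P) (hW : Measurable[m] W)
    (hoW : Integrable (fun ω => inner ℝ (o ω) (W ω)) P) {A : Set Ω} (hA : MeasurableSet[m] A) :
    ∫ ω in A, inner ℝ (o ω) (W ω) ∂P = ∫ ω in A, inner ℝ ((P[o | m]) ω) (W ω) ∂P := by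
  rw [← setIntegral_condExp hm hoW hA]
  refine setIntegral_congr_ae (hm _ hA) ?_
  have := condExp_bilin_of_stronglyMeasurable_right (innerSL ℝ) (m := m) (μ := P) (f := o)
    (g := W) hW.stronglyMeasurable hoW ho
  filter_upwards [this] with ω hω _
  exact hω

variable {K : Set (EuclideanSpace ℝ (Fin d))} {D M₁ Λ : ℝ}
  {f : EuclideanSpace ℝ (Fin d) → ℝ}

lemma ContinuousOn.aemeasurable_comp_of_ae_mem {E F : Type*} [TopologicalSpace E]
    [MeasurableSpace E] [BorelSpace E] {K : Set E} (hK : MeasurableSet K) [Zero F] [TopologicalSpace F]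
    [MeasurableSpace F] [BorelSpace F] {g : E → F} (hg : ContinuousOn g K) {X : Ω → E}
    (hX : Measurable X) (hXK : ∀ᵐ ω ∂P, X ω ∈ K) : AEMeasurable (fun ω => g (X ω)) P := by
  classical
  have hm : Measurable (K.piecewise g 0) := hg.measurable_piecewise continuousOn_const hK
  refine ⟨_, hm.comp hX, ?_⟩
  filter_upwards [hXK] with ω hω
  simp [hω]

lemma IsConstraintSet.isCompact (hK : IsConstraintSet K D) : IsCompact K := by
  refine Metric.isCompact_of_isClosed_isBounded hK.isClosed ?_
  refine (Metric.isBounded_iff).2 ⟨D, fun x hx y hy => ?_⟩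
  rw [dist_eq_norm]
  exact hK.dist_le x hx y hy

lemma IsObjective.integrable_comp [IsProbabilityMeasure P] (hf : IsObjective K M₁ Λ f)
    (hK : IsConstraintSet K D) {X : Ω → EuclideanSpace ℝ (Fin d)} (hX : Measurable X)
    (hXK : ∀ᵐ ω ∂P, X ω ∈ K) : Integrable (fun ω => f (X ω)) P := by
  have hc := hf.continuousOn hK.subset_cube
  obtain ⟨C, hC⟩ := hK.isCompact.exists_bound_of_continuousOn hc
  refine Integrable.of_bound (hc.aemeasurable_comp_of_ae_mem hK.isClosed.measurableSet hX
    hXK).aestronglyMeasurable C ?_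
  filter_upwards [hXK] with ω hω using hC _ hω

end Probability

/-- One round of a block: on the event `A` that the round is the query round, which has
probability `1 / L` and is independent of the past and of `Z`, the feedback yields an estimate
whose correlation with the direction of `y` controls the regret of the action. -/
lemma IsObjective.sub_integral_le_setIntegral_inner {d : ℕ} {Ω : Type*}
    {H G mA mΩ : MeasurableSpace Ω} {P : Measure Ω} [IsProbabilityMeasure P]
    {K : Set (EuclideanSpace ℝ (Fin d))} {D M₁ Λ : ℝ} {f : EuclideanSpace ℝ (Fin d) → ℝ}
    (hf : IsObjective K M₁ Λ f) (hK : IsConstraintSet K D) {y : EuclideanSpace ℝ (Fin d)}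
    (hy : y ∈ K) (hHG : H ≤ G) (hG : G ≤ mΩ) (hAG : mA ≤ G)
    {x o X : Ω → EuclideanSpace ℝ (Fin d)} {Z : Ω → ℝ} {A : Set Ω} {L : ℕ} {B : ℝ}
    (hL : 0 < L) (hx : Measurable[H] x) (hxK : ∀ ω, x ω ∈ K)
    (hZ : MeasurableSpace.comap Z inferInstance ≤ G) (hlaw : P.map Z = bqndLaw)
    (hindZ : Indep (MeasurableSpace.comap Z inferInstance) H P)
    (hA : MeasurableSet[mA] A) (hPA : P.real A = (L : ℝ)⁻¹)
    (hindA : Indep mA (H ⊔ MeasurableSpace.comap Z inferInstance) P)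
    (ho : Measurable o) (hoB : ∀ᵐ ω ∂P, ‖o ω‖ ≤ B)
    (hoX : P[o | G] =ᵐ[P] fun ω => cubeGrad f (X ω))
    (hXA : ∀ ω ∈ A, X ω = expMap (Z ω) (x ω)) :
    Real.exp (-1) * f y - ∫ ω, f (expMap 1 (x ω)) ∂P ≤ (1 - Real.exp (-1)) *
      (L * ∫ ω in A, inner ℝ (o ω) (bqndEstimate (Z ω) (x ω) (y - x ω)) ∂P) := by
  classical
  have hZG : Measurable[G] Z := (comap_measurable Z).mono hZ le_rfl
  have hZm : Measurable Z := hZG.mono hG le_rfl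
  have hxG : Measurable[G] x := hx.mono hHG le_rfl
  have hxm : Measurable x := hxG.mono hG le_rfl
  have hW : Measurable[G] fun ω => bqndEstimate (Z ω) (x ω) (y - x ω) :=
    continuous_bqndEstimate.measurable.comp (hZG.prodMk (hxG.prodMk (hxG.const_sub y)))
  have hZmem : ∀ᵐ ω ∂P, Z ω ∈ Set.Icc (0 : ℝ) 1 :=
    ae_of_ae_map hZm.aemeasurable (by rw [hlaw]; exact ae_bqndLaw_mem)
  have hWD : ∀ x ∈ K, ∀ z ∈ Set.Icc (0 : ℝ) 1, ‖bqndEstimate z x (y - x)‖ ≤ D :=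
    fun x hx z hz => (norm_bqndEstimate_le hz.1 (hK.subset_cube hx) _).trans
      (hK.dist_le y hy x hx)
  have hoi : Integrable o P := Integrable.of_bound ho.aestronglyMeasurable B hoB
  have hoW : Integrable (fun ω => inner ℝ (o ω) (bqndEstimate (Z ω) (x ω) (y - x ω))) P := by
    refine Integrable.of_bound (ho.inner (hW.mono hG le_rfl)).aestronglyMeasurable (B * D) ?_
    filter_upwards [hoB, hZmem] with ω h1 h2
    refine (norm_inner_le_norm _ _).trans ?_
    have h3 := hWD _ (hxK ω) _ h2
    have := (norm_nonneg _).trans h1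
    gcongr
  set S : Set (EuclideanSpace ℝ (Fin d) × ℝ) := K ×ˢ Set.Icc 0 1 with hS
  have hSm : MeasurableSet S := hK.isClosed.measurableSet.prod measurableSet_Icc
  -- The gradient is controlled only on `K`, so the integrand is extended by zero to a bounded
  -- measurable function.
  set ψ : EuclideanSpace ℝ (Fin d) × ℝ → ℝ := S.piecewise
    (fun p => inner ℝ (cubeGrad f (expMap p.2 p.1)) (bqndEstimate p.2 p.1 (y - p.1))) 0 with hψ
  have hψS : ∀ p ∈ S, ψ p =
      inner ℝ (cubeGrad f (expMap p.2 p.1)) (bqndEstimate p.2 p.1 (y - p.1)) :=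
    fun p hp => Set.piecewise_eq_of_mem _ _ _ hp
  have hψm : Measurable ψ := by
    refine ContinuousOn.measurable_piecewise ?_ continuousOn_const hSm
    refine ContinuousOn.inner ?_ ?_
    · exact hf.continuousOn_cubeGrad.comp
        (continuous_expMap.comp continuous_swap).continuousOn
        (fun p hp => expMap_mem hK hp.2 hp.1)
    · exact (continuous_bqndEstimate.comp (continuous_snd.prodMk
        (continuous_fst.prodMk (continuous_const.sub continuous_fst)))).continuousOn
  have hM : 0 ≤ M₁ := (norm_nonneg _).trans (hf.lipschitz y hy)
  have hD : 0 ≤ D := (norm_nonneg _).trans (hK.dist_le y hy y hy)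
  have hψC : ∀ p, ‖ψ p‖ ≤ M₁ * D := by
    intro p
    by_cases hp : p ∈ S
    · rw [hψS p hp]
      refine (norm_inner_le_norm _ _).trans ?_
      have h1 := hf.lipschitz _ (expMap_mem hK hp.2 hp.1)
      have h2 := hWD _ hp.1 _ hp.2
      gcongr
    · rw [hψ, Set.piecewise_eq_of_notMem _ _ _ hp]
      simpa using mul_nonneg hM hD
  have hψHZ : Measurable[H ⊔ MeasurableSpace.comap Z inferInstance] fun ω => ψ (x ω, Z ω) :=
    hψm.comp ((hx.mono le_sup_left le_rfl).prodMk
      ((comap_measurable Z).mono le_sup_right le_rfl))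
  have hHZ : H ⊔ MeasurableSpace.comap Z inferInstance ≤ mΩ :=
    (sup_le hHG hZ).trans hG
  have hψi : Integrable (fun ω => ψ (x ω, Z ω)) P :=
    Integrable.of_bound (hψHZ.mono hHZ le_rfl).aestronglyMeasurable _ (ae_of_all _ fun _ => hψC _)
  -- Both `A` and the direction are `G`-measurable, so the feedback may be replaced by the gradient
  -- at the played point, which on `A` is the query.
  have hstep1 : ∫ ω in A, inner ℝ (o ω) (bqndEstimate (Z ω) (x ω) (y - x ω)) ∂P =
      ∫ ω in A, ψ (x ω, Z ω) ∂P := by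
    rw [setIntegral_inner_condExp hG hoi hW hoW (hAG _ hA)]
    refine setIntegral_congr_ae (hG _ (hAG _ hA)) ?_
    filter_upwards [hoX, hZmem] with ω h1 h2 h3
    rw [h1, hXA ω h3, hψS _ ⟨hxK ω, h2⟩]
  have hindxZ : IndepFun x Z P := by
    rw [IndepFun_iff_Indep]
    exact indep_of_indep_of_le_left hindZ.symm hx.comap_le
  obtain ⟨hint, hpair⟩ := integral_indep_pair hxm hZm hindxZ hψm hψC
  rw [hlaw] at hint hpair
  have hLr : (0 : ℝ) < L := by exact_mod_cast hL
  -- Independence of `A` from the past and `Z` produces the factor `1 / L`, which cancels `L`;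
  -- independence of `x` and `Z` then allows integrating over `Z` alone for fixed `x`.
  rw [hstep1, setIntegral_indep hHZ (hAG.trans hG) hindA.symm hψHZ.stronglyMeasurable hψi hA, hPA,
    mul_inv_cancel_left₀ hLr.ne', hpair, ← integral_const_mul]
  have hact : Integrable (fun ω => f (expMap 1 (x ω))) P :=
    hf.integrable_comp hK (continuous_expMap.measurable.comp (measurable_const.prodMk hxm))
      (ae_of_all _ fun ω => expMap_mem hK ⟨zero_le_one, le_rfl⟩ (hxK ω))
  have hconst : Real.exp (-1) * f y = ∫ _, Real.exp (-1) * f y ∂P := by simp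
  rw [hconst, ← integral_sub (integrable_const _) hact]
  refine integral_mono ((integrable_const _).sub hact) (hint.const_mul _) fun ω => ?_
  refine (hf.sub_le_integral_inner hK (hxK ω) hy).trans_eq ?_
  congr 1
  refine integral_congr_ae ?_
  filter_upwards [ae_bqndLaw_mem] with s hs
  rw [hψS _ ⟨hxK ω, hs⟩]

/-! ### Uniformly random permutations. -/

section Permutation

/-- Composing with a transposition of two values matches their fibres, so all `L` fibres of `σ ↦ σ
a` have the same size. -/
lemma card_perm_apply_eq {L : ℕ} (a p : Fin L) :
    L * (Finset.univ.filter fun σ : Equiv.Perm (Fin L) => σ a = p).card = L.factorial := by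
  have h1 : ∀ p', (Finset.univ.filter fun σ : Equiv.Perm (Fin L) => σ a = p').card =
      (Finset.univ.filter fun σ : Equiv.Perm (Fin L) => σ a = p).card := by
    intro p'
    refine Finset.card_equiv (Equiv.mulLeft (Equiv.swap p' p)) fun σ => ?_
    simp [Equiv.swap_apply_eq_iff]
  have h2 := Finset.card_eq_sum_card_fiberwise (f := fun σ : Equiv.Perm (Fin L) => σ a)
    (s := Finset.univ) (t := Finset.univ) (by simp [Set.MapsTo])
  rw [Finset.sum_congr rfl fun p' _ => h1 p'] at h2
  simpa [Fintype.card_perm] using h2.symm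

/-- The first entry of a uniformly random permutation is uniformly distributed. -/
lemma measureReal_perm_apply_eq {Ω : Type*} {mΩ : MeasurableSpace Ω} {P : Measure Ω} {L : ℕ}
    (hL : 0 < L) {σ : Ω → Equiv.Perm (Fin L)} (hm : ∀ p, MeasurableSet {ω | σ ω = p})
    (hlaw : ∀ p, P {ω | σ ω = p} = ((L.factorial : ℕ) : ENNReal)⁻¹) (a p : Fin L) :
    P.real {ω | σ ω a = p} = (L : ℝ)⁻¹ := by
  have h1 : {ω | σ ω a = p} =
      ⋃ τ ∈ Finset.univ.filter fun τ : Equiv.Perm (Fin L) => τ a = p, {ω | σ ω = τ} := by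
    ext ω
    simp
  have h2 : P {ω | σ ω a = p} =
      (Finset.univ.filter fun τ : Equiv.Perm (Fin L) => τ a = p).card *
        ((L.factorial : ℕ) : ENNReal)⁻¹ := by
    rw [h1, measure_biUnion_finset ?_ fun τ _ => hm τ]
    · simp [hlaw]
    · intro τ _ τ' _ hne
      refine Set.disjoint_left.2 fun ω h h' => hne ?_
      exact h.symm.trans h'
  have h3 := card_perm_apply_eq a p
  have h4 : (0 : ℝ) < L := by exact_mod_cast hL
  have h5 : (0 : ℝ) < L.factorial := by exact_mod_cast L.factorial_pos
  rw [Measure.real, h2, ENNReal.toReal_mul, ENNReal.toReal_inv, ENNReal.toReal_natCast,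
    ENNReal.toReal_natCast, ← div_eq_mul_inv, div_eq_iff h5.ne', ← h3]
  push_cast
  field_simp

end Permutation

/-! ### Regret of the base learner -/

section BaseRegret

variable {d : ℕ} {K : Set (EuclideanSpace ℝ (Fin d))} {c : EuclideanSpace ℝ (Fin d)}
  {SO : EuclideanSpace ℝ (Fin d) → EuclideanSpace ℝ (Fin d)} {D δ η r : ℝ}

/-- Regret of online gradient ascent with infeasible projections on an interval of rounds. -/
lemma sum_inner_le_of_soOGAStep (hK : IsConstraintSet K D) (hSO : IsSeparationOracle K SO)
    (hD : 0 < D) (hδ : 0 < δ) (hδr : δ < r) (hc : c ∈ K)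
    (hcen : ∀ w ∈ vectorSpan ℝ K, ‖w‖ < r → c + w ∈ K) (hη : 0 < η)
    {x g : ℕ → EuclideanSpace ℝ (Fin d)} {B : ℝ} {q₀ q₁ : ℕ} (hq : q₀ ≤ q₁)
    (hx : ∀ q, x q ∈ K) (hstep : ∀ q, x (q + 1) = soOGAStep K c D SO δ η (x q) (g q))
    (hg : ∀ q < q₁, ‖g q‖ ≤ B) {y : EuclideanSpace ℝ (Fin d)} (hy : y ∈ K) :
    ∑ q ∈ Finset.Ico q₀ q₁, inner ℝ (g q) (y - x q) ≤
      D ^ 2 / (2 * η) + (q₁ - q₀ : ℝ) * (η * B ^ 2 / 2 + B * (δ / r * D)) := by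
  have hr : 0 < r := hδ.trans hδr
  set u := y + (δ / r) • (c - y) with hu
  have hum := margin_shrink hK.convex hδ hδr hcen hy
  have huK : u ∈ K := by simpa using hum 0 (Submodule.zero_mem _) (by simpa using hδ)
  -- The induction keeps the unspent potential `-‖x q - u‖ ^ 2` so that the sum telescopes. Its
  -- start uses only the diameter bound, hence any `q₀` is allowed.
  have htel : ∀ q, q₀ ≤ q → q ≤ q₁ → ∑ j ∈ Finset.Ico q₀ q, inner ℝ (g j) (y - x j) ≤
      (D ^ 2 - ‖x q - u‖ ^ 2) / (2 * η) +
        (q - q₀ : ℝ) * (η * B ^ 2 / 2 + B * (δ / r * D)) := by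
    intro q hq
    induction q, hq using Nat.le_induction with
    | base =>
      intro _
      have h1 : ‖x q₀ - u‖ ^ 2 ≤ D ^ 2 := by
        have := hK.dist_le _ (hx q₀) _ huK
        gcongr
      have h2 : 0 ≤ (D ^ 2 - ‖x q₀ - u‖ ^ 2) / (2 * η) := div_nonneg (by linarith) (by linarith)
      simpa using h2
    | succ q hq ih =>
      intro hle
      have h0 := ih (by omega)
      have hgB := hg q (by omega)
      have h1 := two_mul_inner_le_of_soOGAStep hSO hD hδ hc (fun x hx => hK.dist_le x hx c hc)
        hum η (x q) (g q)
      rw [← hstep, ← hu] at h1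
      -- Replacing `y` by the shrunk comparator `u` costs at most `B * (δ / r * D)` per step.
      have h2 : inner ℝ (g q) (y - x q) = inner ℝ (g q) (u - x q) +
          inner ℝ (g q) ((δ / r) • (y - c)) := by
        rw [← inner_add_right]
        congr 1
        rw [hu]
        module
      have h3 : inner ℝ (g q) ((δ / r) • (y - c)) ≤ B * (δ / r * D) := by
        refine (real_inner_le_norm _ _).trans ?_
        rw [norm_smul, Real.norm_of_nonneg (by positivity)]
        have := hK.dist_le y hy c hc
        have := (norm_nonneg _).trans hgB
        gcongr
      have h4 : inner ℝ (g q) (u - x q) ≤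
          (‖x q - u‖ ^ 2 - ‖x (q + 1) - u‖ ^ 2) / (2 * η) + η * B ^ 2 / 2 := by
        have h5 : η ^ 2 * ‖g q‖ ^ 2 ≤ η ^ 2 * B ^ 2 := by gcongr
        have h6 : (‖x q - u‖ ^ 2 - ‖x (q + 1) - u‖ ^ 2) / (2 * η) + η * B ^ 2 / 2 =
            (‖x q - u‖ ^ 2 - ‖x (q + 1) - u‖ ^ 2 + η ^ 2 * B ^ 2) / (2 * η) := by
          field_simp
        rw [h6, le_div_iff₀ (by linarith)]
        linarith
      rw [Finset.sum_Ico_succ_top (by omega), h2]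
      have h7 : (D ^ 2 - ‖x (q + 1) - u‖ ^ 2) / (2 * η) = (D ^ 2 - ‖x q - u‖ ^ 2) / (2 * η) +
          (‖x q - u‖ ^ 2 - ‖x (q + 1) - u‖ ^ 2) / (2 * η) := by ring
      rw [h7]
      push_cast
      linarith
  refine (htel q₁ hq le_rfl).trans ?_
  gcongr
  linarith [sq_nonneg ‖x q₁ - u‖]

end BaseRegret

/-! ### The run of the blocking meta-algorithm -/

/-- The iterate of the base learner in block `q`, as a random variable. -/
noncomputable def runIterate {d L : ℕ} {Ω : Type*} (K : Set (EuclideanSpace ℝ (Fin d)))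
    (c : EuclideanSpace ℝ (Fin d)) (D : ℝ)
    (SO : EuclideanSpace ℝ (Fin d) → EuclideanSpace ℝ (Fin d)) (δ η : ℝ) (hL : 0 < L)
    (z : ℕ → Ω → ℝ) (π : ℕ → Ω → Equiv.Perm (Fin L)) (o : ℕ → Ω → EuclideanSpace ℝ (Fin d))
    (q : ℕ) (ω : Ω) : EuclideanSpace ℝ (Fin d) :=
  baseIterate K c D SO δ η hL (fun q => z q ω) (fun q => π q ω) (fun s => o s ω) q

/-- The gradient estimate that is fed to the base learner in block `q`, as a random variable. -/
noncomputable def runEstimate {d L : ℕ} {Ω : Type*} (K : Set (EuclideanSpace ℝ (Fin d)))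
    (c : EuclideanSpace ℝ (Fin d)) (D : ℝ)
    (SO : EuclideanSpace ℝ (Fin d) → EuclideanSpace ℝ (Fin d)) (δ η : ℝ) (hL : 0 < L)
    (z : ℕ → Ω → ℝ) (π : ℕ → Ω → Equiv.Perm (Fin L)) (o : ℕ → Ω → EuclideanSpace ℝ (Fin d))
    (q : ℕ) (ω : Ω) : EuclideanSpace ℝ (Fin d) :=
  bqndEstimate (z q ω) (runIterate K c D SO δ η hL z π o q ω)
    (o (queryRound hL (fun q => π q ω) q) ω)

/-- The standing assumptions on a run, for an arbitrary block size and arbitrary parameters of the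
base learner. -/
structure IsBlockingRun {d L : ℕ} {Ω : Type*} [MeasurableSpace Ω] (P : Measure Ω)
    (K : Set (EuclideanSpace ℝ (Fin d))) (c : EuclideanSpace ℝ (Fin d)) (D r : ℝ)
    (SO : EuclideanSpace ℝ (Fin d) → EuclideanSpace ℝ (Fin d)) (M₁ B₁ Λ : ℝ) (T : ℕ)
    (f : ℕ → EuclideanSpace ℝ (Fin d) → ℝ) (δ η : ℝ) (hL : 0 < L)
    (z : ℕ → Ω → ℝ) (π : ℕ → Ω → Equiv.Perm (Fin L))
    (o X : ℕ → Ω → EuclideanSpace ℝ (Fin d)) : Prop where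
  constraint : IsConstraintSet K D
  center_mem : c ∈ K
  center_margin : ∀ w ∈ vectorSpan ℝ K, ‖w‖ < r → c + w ∈ K
  oracle : IsSeparationOracle K SO
  measurable_oracle : Measurable SO
  diam_pos : 0 < D
  margin_pos : 0 < δ
  margin_lt : δ < r
  stepSize_pos : 0 < η
  objective : ∀ t < T, IsObjective K M₁ Λ (f t)
  isProbabilityMeasure : IsProbabilityMeasure P
  played : ∀ t ω, X t ω = playedAction K c D SO δ η hL
    (fun q => z q ω) (fun q => π q ω) (fun s => o s ω) t
  run : IsSemiBanditRun P T B₁ f z π o X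

namespace IsBlockingRun

variable {d L : ℕ} {Ω : Type*} {mΩ : MeasurableSpace Ω} {P : Measure Ω}
  {K : Set (EuclideanSpace ℝ (Fin d))} {c : EuclideanSpace ℝ (Fin d)} {D r : ℝ}
  {SO : EuclideanSpace ℝ (Fin d) → EuclideanSpace ℝ (Fin d)} {M₁ B₁ Λ : ℝ} {T : ℕ}
  {f : ℕ → EuclideanSpace ℝ (Fin d) → ℝ} {δ η : ℝ} {hL : 0 < L}
  {z : ℕ → Ω → ℝ} {π : ℕ → Ω → Equiv.Perm (Fin L)}
  {o X : ℕ → Ω → EuclideanSpace ℝ (Fin d)}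

local notation "xᵣ" => runIterate K c D SO δ η hL z π o
local notation "gᵣ" => runEstimate K c D SO δ η hL z π o

lemma iterate_mem (h : IsBlockingRun P K c D r SO M₁ B₁ Λ T f δ η hL z π o X) (q : ℕ) (ω : Ω) :
    xᵣ q ω ∈ K :=
  baseIterate_mem h.oracle h.margin_pos h.margin_lt h.center_mem h.center_margin hL _ _ _ q

lemma measurable_iterate (h : IsBlockingRun P K c D r SO M₁ B₁ Λ T f δ η hL z π o X) (q : ℕ) :
    Measurable[blockHistory z π o q] (xᵣ q) :=
  measurable_baseIterate h.constraint.isClosed h.oracle h.measurable_oracle h.margin_pos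
    h.margin_lt h.center_mem h.center_margin hL q

lemma ae_coin_mem (h : IsBlockingRun P K c D r SO M₁ B₁ Λ T f δ η hL z π o X) {q : ℕ}
    (hq : q * L < T) : ∀ᵐ ω ∂P, z q ω ∈ Set.Icc (0 : ℝ) 1 :=
  ae_of_ae_map (h.run.measurable_z q hq).aemeasurable
    (by rw [h.run.law_z q hq]; exact ae_bqndLaw_mem)

lemma measurableSet_query (h : IsBlockingRun P K c D r SO M₁ B₁ Λ T f δ η hL z π o X) {q : ℕ}
    (hq : q * L < T) (t : ℕ) : MeasurableSet {ω | t = queryRound hL (fun q => π q ω) q} :=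
  comap_perm_le (h.run.measurable_perm q hq) _
    ⟨{σ | t = q * L + (σ ⟨0, hL⟩ : Fin L)}, trivial, rfl⟩

lemma measurable_iterate' (h : IsBlockingRun P K c D r SO M₁ B₁ Λ T f δ η hL z π o X) {q : ℕ}
    (hq : q * L ≤ T) : Measurable (xᵣ q) :=
  (h.measurable_iterate q).mono (h.run.blockHistory_le hL hq) le_rfl

lemma played_eq (h : IsBlockingRun P K c D r SO M₁ B₁ Λ T f δ η hL z π o X) (t : ℕ) (ω : Ω) :
    X t ω = if t = queryRound hL (fun q => π q ω) (t / L) then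
      expMap (z (t / L) ω) (xᵣ (t / L) ω) else expMap 1 (xᵣ (t / L) ω) :=
  h.played t ω

lemma action_mem (h : IsBlockingRun P K c D r SO M₁ B₁ Λ T f δ η hL z π o X) (q : ℕ) (ω : Ω) :
    expMap 1 (xᵣ q ω) ∈ K :=
  expMap_mem h.constraint ⟨zero_le_one, le_rfl⟩ (h.iterate_mem q ω)

lemma ae_played_mem (h : IsBlockingRun P K c D r SO M₁ B₁ Λ T f δ η hL z π o X) {t : ℕ}
    (ht : t < T) : ∀ᵐ ω ∂P, X t ω ∈ K := by
  filter_upwards [h.ae_coin_mem ((Nat.div_mul_le_self t L).trans_lt ht)] with ω hω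
  rw [h.played_eq]
  split_ifs
  · exact expMap_mem h.constraint hω (h.iterate_mem _ ω)
  · exact h.action_mem _ ω

lemma measurable_played (h : IsBlockingRun P K c D r SO M₁ B₁ Λ T f δ η hL z π o X) {t : ℕ}
    (ht : t < T) : Measurable (X t) := by
  have hq := (Nat.div_mul_le_self t L).trans_lt ht
  rw [funext (h.played_eq t)]
  have hx := h.measurable_iterate' hq.le
  exact Measurable.ite (h.measurableSet_query hq t)
    (continuous_expMap.measurable.comp ((h.run.measurable_z _ hq).prodMk hx))
    (continuous_expMap.measurable.comp (measurable_const.prodMk hx))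

lemma integrable_played (h : IsBlockingRun P K c D r SO M₁ B₁ Λ T f δ η hL z π o X) {t : ℕ}
    (ht : t < T) : Integrable (fun ω => f t (X t ω)) P :=
  have := h.isProbabilityMeasure
  (h.objective t ht).integrable_comp h.constraint (h.measurable_played ht) (h.ae_played_mem ht)

lemma integrable_action (h : IsBlockingRun P K c D r SO M₁ B₁ Λ T f δ η hL z π o X) {t q : ℕ}
    (ht : t < T) (hq : q * L ≤ T) : Integrable (fun ω => f t (expMap 1 (xᵣ q ω))) P :=
  have := h.isProbabilityMeasure
  (h.objective t ht).integrable_comp h.constraint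
    (continuous_expMap.measurable.comp (measurable_const.prodMk (h.measurable_iterate' hq)))
    (ae_of_all _ fun ω => h.action_mem q ω)

lemma round_lt {q : ℕ} (hq : (q + 1) * L ≤ T) (p : Fin L) : q * L + p < T := by
  have := p.2
  rw [Nat.succ_mul] at hq
  omega

lemma round_div (hL : 0 < L) (q : ℕ) (p : Fin L) : (q * L + p) / L = q := by
  rw [mul_comm, Nat.mul_add_div hL, Nat.div_eq_of_lt p.2, add_zero]

lemma round_eq_query_iff (q : ℕ) (p : Fin L) (ω : Ω) :
    q * L + p = queryRound hL (fun q => π q ω) q ↔ π q ω ⟨0, hL⟩ = p := by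
  rw [queryRound, Nat.add_left_cancel_iff, Fin.val_inj, eq_comm]

lemma ae_norm_estimate_le (h : IsBlockingRun P K c D r SO M₁ B₁ Λ T f δ η hL z π o X) {q : ℕ}
    (hq : (q + 1) * L ≤ T) : ∀ᵐ ω ∂P, ‖gᵣ q ω‖ ≤ B₁ := by
  have hb : ∀ᵐ ω ∂P, ∀ p : Fin L, ‖o (q * L + p) ω‖ ≤ B₁ :=
    ae_all_iff.2 fun p => h.run.bounded _ (round_lt hq p)
  filter_upwards [hb, h.ae_coin_mem (q := q) (by rw [Nat.succ_mul] at hq; omega)] with ω h1 h2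
  exact (norm_bqndEstimate_le h2.1 (h.constraint.subset_cube (h.iterate_mem q ω)) _).trans
    (h1 (π q ω ⟨0, hL⟩))

lemma measurable_estimate (h : IsBlockingRun P K c D r SO M₁ B₁ Λ T f δ η hL z π o X) {q : ℕ}
    (hq : (q + 1) * L ≤ T) : Measurable (gᵣ q) := by
  have hq' : q * L < T := by rw [Nat.succ_mul] at hq; omega
  have ho : Measurable fun ω => o (queryRound hL (fun q => π q ω) q) ω :=
    Measurable.finite_choice (F := fun p : Fin L => o (q * L + p))
      (N := fun ω => π q ω ⟨0, hL⟩) (fun p => h.run.measurable_feedback _ (round_lt hq p))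
      (fun p => by
        simpa only [round_eq_query_iff] using h.measurableSet_query hq' (q * L + p))
  exact continuous_bqndEstimate.measurable.comp ((h.run.measurable_z q hq').prodMk
    ((h.measurable_iterate' hq'.le).prodMk ho))

lemma integrable_inner_estimate (h : IsBlockingRun P K c D r SO M₁ B₁ Λ T f δ η hL z π o X)
    {q : ℕ} (hq : (q + 1) * L ≤ T) {y : EuclideanSpace ℝ (Fin d)} (hy : y ∈ K) :
    Integrable (fun ω => inner ℝ (gᵣ q ω) (y - xᵣ q ω)) P := by
  have := h.isProbabilityMeasure
  have hq' : q * L ≤ T := by rw [Nat.succ_mul] at hq; omega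
  refine Integrable.of_bound ((h.measurable_estimate hq).inner
    ((h.measurable_iterate' hq').const_sub y)).aestronglyMeasurable (B₁ * D) ?_
  filter_upwards [h.ae_norm_estimate_le hq] with ω hω
  refine (norm_inner_le_norm _ _).trans ?_
  have := h.constraint.dist_le y hy _ (h.iterate_mem q ω)
  have := (norm_nonneg _).trans hω
  gcongr

/-- Within a block, the regret of the action is controlled by the linear regret of the base
learner. -/
lemma sum_action_gap_le (h : IsBlockingRun P K c D r SO M₁ B₁ Λ T f δ η hL z π o X)
    {q : ℕ} (hq : (q + 1) * L ≤ T) {y : EuclideanSpace ℝ (Fin d)} (hy : y ∈ K) :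
    ∑ p : Fin L, (Real.exp (-1) * f (q * L + p) y -
        ∫ ω, f (q * L + p) (expMap 1 (xᵣ q ω)) ∂P) ≤
      (1 - Real.exp (-1)) * (L * ∫ ω, inner ℝ (gᵣ q ω) (y - xᵣ q ω) ∂P) := by
  have := h.isProbabilityMeasure
  have hq' : q * L < T := by rw [Nat.succ_mul] at hq; omega
  have hA : ∀ p : Fin L, MeasurableSet {ω | π q ω ⟨0, hL⟩ = p} := fun p => by
    simpa only [round_eq_query_iff] using h.measurableSet_query hq' (q * L + p)
  -- The sample space is split by the position of the query round; each piece involves the feedback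
  -- of one fixed round.
  have hsplit : ∫ ω, inner ℝ (gᵣ q ω) (y - xᵣ q ω) ∂P = ∑ p : Fin L,
      ∫ ω in {ω | π q ω ⟨0, hL⟩ = p}, inner ℝ (o (q * L + p) ω)
        (bqndEstimate (z q ω) (xᵣ q ω) (y - xᵣ q ω)) ∂P := by
    have h1 := integral_iUnion_fintype hA
      (fun p p' hne => Set.disjoint_left.2 fun ω h1 h2 => hne (h1.symm.trans h2))
      (f := fun ω => inner ℝ (gᵣ q ω) (y - xᵣ q ω)) (μ := P)
      (fun p => (h.integrable_inner_estimate hq hy).integrableOn)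
    have h2 : ⋃ p : Fin L, {ω | π q ω ⟨0, hL⟩ = p} = Set.univ := by
      ext ω
      simp
    rw [h2, setIntegral_univ] at h1
    rw [h1]
    refine Finset.sum_congr rfl fun p _ => setIntegral_congr_fun (hA p) fun ω hω => ?_
    simp only [runEstimate, inner_bqndEstimate_left, queryRound]
    rw [show π q ω ⟨0, hL⟩ = p from hω]
  rw [hsplit, Finset.mul_sum, Finset.mul_sum]
  refine Finset.sum_le_sum fun p _ => ?_
  have ht := round_lt hq p
  have hdiv := round_div hL q p
  have hG := h.run.roundHistory_le ht
  refine (h.objective _ ht).sub_integral_le_setIntegral_inner h.constraint hy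
    (H := blockHistory z π o q) (G := roundHistory z π o (q * L + p))
    (mA := MeasurableSpace.comap (π q) ⊤) (X := X (q * L + p)) (B := B₁) ?_ hG ?_ hL
    (h.measurable_iterate q) (h.iterate_mem q) ?_ (h.run.law_z q hq') (h.run.indep_z q hq')
    ⟨{σ | σ ⟨0, hL⟩ = p}, trivial, rfl⟩
    (measureReal_perm_apply_eq hL (h.run.measurable_perm q hq') (h.run.law_perm q hq') _ p)
    (h.run.indep_perm q hq') (h.run.measurable_feedback _ ht) (h.run.bounded _ ht)
    (h.run.unbiased _ ht) ?_
  · simpa only [hdiv] using blockHistory_le_roundHistory (z := z) (π := π) (o := o) (q * L + p)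
  · simpa only [hdiv] using comap_perm_le_roundHistory (z := z) (π := π) (o := o) (q * L + p)
  · simpa only [hdiv] using comap_coin_le_roundHistory (z := z) (π := π) (o := o) (q * L + p)
  · intro ω hω
    rw [h.played_eq, hdiv, if_pos ((round_eq_query_iff q p ω).2 hω)]

/-- The query round of a block costs at most `M₁ * D`. -/
lemma sum_action_sub_played_le (h : IsBlockingRun P K c D r SO M₁ B₁ Λ T f δ η hL z π o X)
    {q : ℕ} (hq : (q + 1) * L ≤ T) :
    ∑ p : Fin L, (∫ ω, f (q * L + p) (expMap 1 (xᵣ q ω)) ∂P -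
      ∫ ω, f (q * L + p) (X (q * L + p) ω) ∂P) ≤ M₁ * D := by
  have := h.isProbabilityMeasure
  have hq' : q * L ≤ T := by rw [Nat.succ_mul] at hq; omega
  have hint : ∀ p : Fin L, Integrable (fun ω => f (q * L + p) (expMap 1 (xᵣ q ω)) -
      f (q * L + p) (X (q * L + p) ω)) P := fun p =>
    (h.integrable_action (round_lt hq p) hq').sub (h.integrable_played (round_lt hq p))
  rw [Finset.sum_congr rfl fun p _ => (integral_sub (h.integrable_action (round_lt hq p) hq')
    (h.integrable_played (round_lt hq p))).symm, ← integral_finsetSum _ fun p _ => hint p]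
  have hmem : ∀ᵐ ω ∂P, ∀ p : Fin L, X (q * L + p) ω ∈ K :=
    ae_all_iff.2 fun p => h.ae_played_mem (round_lt hq p)
  have hbound : ∀ᵐ ω ∂P, ∑ p : Fin L, (f (q * L + p) (expMap 1 (xᵣ q ω)) -
      f (q * L + p) (X (q * L + p) ω)) ≤ M₁ * D := by
    filter_upwards [hmem] with ω hω
    -- For each outcome, action and played point differ only in the query round. That round is
    -- random, so the sum has to be bounded under the integral.
    rw [Finset.sum_eq_single (π q ω ⟨0, hL⟩)]
    · exact (h.objective _ (round_lt hq _)).sub_le h.constraint (hω _) (h.action_mem q ω)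
    · intro p _ hp
      rw [h.played_eq, round_div hL, if_neg, sub_self]
      rw [round_eq_query_iff]
      exact hp.symm
    · simp
  simpa using integral_mono_ae (integrable_finsetSum _ fun p _ => hint p)
    (integrable_const (M₁ * D)) hbound

/-- In a single round the regret is at most `M₁ * D`. -/
lemma gap_le (h : IsBlockingRun P K c D r SO M₁ B₁ Λ T f δ η hL z π o X) {t : ℕ} (ht : t < T)
    {y : EuclideanSpace ℝ (Fin d)} (hy : y ∈ K) :
    Real.exp (-1) * f t y - ∫ ω, f t (X t ω) ∂P ≤ M₁ * D := by
  have := h.isProbabilityMeasure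
  have h1 : f t y - M₁ * D ≤ ∫ ω, f t (X t ω) ∂P := by
    have h2 : f t y - M₁ * D = ∫ _, (f t y - M₁ * D) ∂P := by simp
    rw [h2]
    refine integral_mono_ae (integrable_const _) (h.integrable_played ht) ?_
    filter_upwards [h.ae_played_mem ht] with ω hω
    linarith [(h.objective t ht).sub_le h.constraint hω hy]
  have h3 : Real.exp (-1) * f t y ≤ f t y :=
    mul_le_of_le_one_left ((h.objective t ht).nonneg y (h.constraint.subset_cube hy))
      (Real.exp_le_one_iff.2 (by norm_num))
  linarith

/-- Expected linear regret of the base learner over an interval of complete blocks. -/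
lemma sum_integral_inner_le (h : IsBlockingRun P K c D r SO M₁ B₁ Λ T f δ η hL z π o X)
    {q₀ q₁ : ℕ} (hq : q₀ ≤ q₁) (hq₁ : q₁ * L ≤ T) {y : EuclideanSpace ℝ (Fin d)} (hy : y ∈ K) :
    ∑ q ∈ Finset.Ico q₀ q₁, ∫ ω, inner ℝ (gᵣ q ω) (y - xᵣ q ω) ∂P ≤
      D ^ 2 / (2 * η) + (q₁ - q₀ : ℝ) * (η * B₁ ^ 2 / 2 + B₁ * (δ / r * D)) := by
  have := h.isProbabilityMeasure
  have hlt : ∀ q < q₁, (q + 1) * L ≤ T := fun q hq => (Nat.mul_le_mul_right L hq).trans hq₁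
  have hint : ∀ q ∈ Finset.Ico q₀ q₁, Integrable
      (fun ω => inner ℝ (gᵣ q ω) (y - xᵣ q ω)) P := fun q hq =>
    h.integrable_inner_estimate (hlt q (Finset.mem_Ico.1 hq).2) hy
  rw [← integral_finsetSum _ hint]
  have hg : ∀ᵐ ω ∂P, ∀ q < q₁, ‖gᵣ q ω‖ ≤ B₁ :=
    ae_all_iff.2 fun q => Filter.eventually_imp_distrib_left.2 fun hq => h.ae_norm_estimate_le (hlt q hq)
  have hbound : ∀ᵐ ω ∂P, ∑ q ∈ Finset.Ico q₀ q₁, inner ℝ (gᵣ q ω) (y - xᵣ q ω) ≤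
      D ^ 2 / (2 * η) + (q₁ - q₀ : ℝ) * (η * B₁ ^ 2 / 2 + B₁ * (δ / r * D)) := by
    filter_upwards [hg] with ω hω
    exact sum_inner_le_of_soOGAStep h.constraint h.oracle h.diam_pos h.margin_pos h.margin_lt
      h.center_mem h.center_margin h.stepSize_pos hq (x := fun q => xᵣ q ω)
      (g := fun q => gᵣ q ω) (fun q => h.iterate_mem q ω) (fun q => rfl) hω hy
  simpa using integral_mono_ae (integrable_finsetSum _ hint) (integrable_const _) hbound

end IsBlockingRun

/-! ### Regret of the blocking meta-algorithm -/

section Blocks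

lemma sum_Ico_blocks (G : ℕ → ℝ) (L : ℕ) {q₀ q₁ : ℕ} (hq : q₀ ≤ q₁) :
    ∑ t ∈ Finset.Ico (q₀ * L) (q₁ * L), G t =
      ∑ q ∈ Finset.Ico q₀ q₁, ∑ p : Fin L, G (q * L + p) := by
  induction q₁, hq using Nat.le_induction with
  | base => simp
  | succ q hq ih =>
    rw [Finset.sum_Ico_succ_top hq, ← ih,
      ← Finset.sum_Ico_consecutive G (Nat.mul_le_mul_right L hq)
        (Nat.mul_le_mul_right L q.le_succ), Finset.sum_Ico_eq_sum_range G (q * L),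
      Fin.sum_univ_eq_sum_range (fun p => G (q * L + p)), Nat.succ_mul, Nat.add_sub_cancel_left]

lemma sum_Ico_le_mul {G : ℕ → ℝ} {m : ℝ} (hm : 0 ≤ m) {a b n : ℕ} (hn : b ≤ a + n)
    (hG : ∀ t < b, G t ≤ m) : ∑ t ∈ Finset.Ico a b, G t ≤ n * m := by
  refine (Finset.sum_le_card_nsmul _ _ m fun t ht => hG t (Finset.mem_Ico.1 ht).2).trans ?_
  rw [nsmul_eq_mul, Nat.card_Ico]
  gcongr
  omega

/-- An interval of rounds consists of complete blocks and of less than `2 * L` further rounds. -/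
lemma exists_blocks_sum_le {G : ℕ → ℝ} {m : ℝ} (hm : 0 ≤ m) {L T a b : ℕ} (hL : 0 < L)
    (hb : b < T) (hG : ∀ t < T, G t ≤ m) : ∃ q₀ q₁ : ℕ, q₀ ≤ q₁ ∧ q₁ * L ≤ T ∧
      ∑ t ∈ Finset.Icc a b, G t ≤
        2 * L * m + ∑ q ∈ Finset.Ico q₀ q₁, ∑ p : Fin L, G (q * L + p) := by
  have hIcc : Finset.Icc a b = Finset.Ico a (b + 1) := by
    ext t
    simp
  have h1 : (b + 1) / L * L ≤ b + 1 := Nat.div_mul_le_self _ _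
  have h2 : b + 1 < (b + 1) / L * L + L := Nat.lt_div_mul_add hL
  have h3 : a ≤ (a + L - 1) / L * L := by
    have := Nat.lt_div_mul_add (a := a + L - 1) hL
    omega
  have h4 : (a + L - 1) / L * L < a + L := by
    have := Nat.div_mul_le_self (a + L - 1) L
    omega
  rw [hIcc]
  -- The complete blocks run from `a / L` rounded up to `(b + 1) / L` rounded down, with fewer than
  -- `L` rounds left over on each side. If these bounds cross, the whole interval is short and an
  -- empty range of blocks serves.
  rcases le_or_gt ((a + L - 1) / L) ((b + 1) / L) with hle | hlt
  · have h5 := Nat.mul_le_mul_right L hle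
    refine ⟨_, _, hle, h1.trans hb, ?_⟩
    rw [← sum_Ico_blocks G L hle, ← Finset.sum_Ico_consecutive G h3 (h5.trans h1),
      ← Finset.sum_Ico_consecutive G h5 h1]
    have h6 := sum_Ico_le_mul hm h4.le (fun t ht => hG t (ht.trans_le ((h5.trans h1).trans hb)))
    have h7 := sum_Ico_le_mul hm h2.le (fun t ht => hG t (ht.trans_le hb))
    linarith
  · refine ⟨0, 0, le_rfl, by simp, ?_⟩
    have h5 := Nat.mul_le_mul_right L hlt
    rw [Nat.succ_mul] at h5
    have h6 := sum_Ico_le_mul (a := a) (n := 2 * L) hm (by omega)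
      (fun t ht => hG t (ht.trans_le hb))
    simpa using h6

/-- Regret on an interval of rounds, in terms of the block size and the parameters of the base
learner. -/
lemma IsBlockingRun.sum_gap_le {d L : ℕ} {Ω : Type*} {mΩ : MeasurableSpace Ω} {P : Measure Ω}
    {K : Set (EuclideanSpace ℝ (Fin d))} {c : EuclideanSpace ℝ (Fin d)} {D r : ℝ}
    {SO : EuclideanSpace ℝ (Fin d) → EuclideanSpace ℝ (Fin d)} {M₁ B₁ Λ : ℝ} {T : ℕ}
    {f : ℕ → EuclideanSpace ℝ (Fin d) → ℝ} {δ η : ℝ} {hL : 0 < L}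
    {z : ℕ → Ω → ℝ} {π : ℕ → Ω → Equiv.Perm (Fin L)}
    {o X : ℕ → Ω → EuclideanSpace ℝ (Fin d)}
    (h : IsBlockingRun P K c D r SO M₁ B₁ Λ T f δ η hL z π o X) (hM : 0 ≤ M₁) (hB : 0 ≤ B₁)
    {N : ℝ} (hN : (T : ℝ) / L ≤ N) {a b : ℕ} (hb : b < T)
    {y : EuclideanSpace ℝ (Fin d)} (hy : y ∈ K) :
    ∑ t ∈ Finset.Icc a b, (Real.exp (-1) * f t y - ∫ ω, f t (X t ω) ∂P) ≤
      2 * L * (M₁ * D) + N * (M₁ * D) +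
        L * (D ^ 2 / (2 * η) + N * (η * B₁ ^ 2 / 2 + B₁ * (δ / r * D))) := by
  have hD := h.diam_pos
  have hδ := h.margin_pos
  have hr := hδ.trans h.margin_lt
  have hη := h.stepSize_pos
  have hLr : (0 : ℝ) < L := by exact_mod_cast hL
  obtain ⟨q₀, q₁, hq, hq₁, hsum⟩ := exists_blocks_sum_le (a := a) (by positivity) hL hb
    (fun t ht => h.gap_le ht hy)
  refine hsum.trans ?_
  have hn : (q₁ - q₀ : ℝ) ≤ N := by
    refine le_trans ?_ hN
    rw [le_div_iff₀ hLr]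
    have h1 : (q₁ : ℝ) * L ≤ T := by exact_mod_cast hq₁
    have h2 : (0 : ℝ) ≤ q₀ * L := by positivity
    linarith
  have hn0 : (0 : ℝ) ≤ q₁ - q₀ := by
    rw [sub_nonneg]
    exact_mod_cast hq
  set lin : ℕ → ℝ := fun q => ∫ ω, inner ℝ (runEstimate K c D SO δ η hL z π o q ω)
    (y - runIterate K c D SO δ η hL z π o q ω) ∂P with hlin
  have hblock : ∀ q ∈ Finset.Ico q₀ q₁, ∑ p : Fin L, (Real.exp (-1) * f (q * L + p) y -
      ∫ ω, f (q * L + p) (X (q * L + p) ω) ∂P) ≤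
        (1 - Real.exp (-1)) * L * lin q + M₁ * D := by
    intro q hqm
    have hqT : (q + 1) * L ≤ T :=
      (Nat.mul_le_mul_right L (Finset.mem_Ico.1 hqm).2).trans hq₁
    have h1 := h.sum_action_gap_le hqT hy
    have h2 := h.sum_action_sub_played_le hqT
    have h3 := add_le_add h1 h2
    rw [← Finset.sum_add_distrib] at h3
    simp only [sub_add_sub_cancel] at h3
    rw [mul_assoc]
    exact h3
  have hR := h.sum_integral_inner_le hq hq₁ hy
  set R := D ^ 2 / (2 * η) + N * (η * B₁ ^ 2 / 2 + B₁ * (δ / r * D)) with hRdef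
  have hN0 : 0 ≤ N := hn0.trans hn
  have hR0 : 0 ≤ R := by positivity
  have hR' : ∑ q ∈ Finset.Ico q₀ q₁, lin q ≤ R := by
    refine hR.trans ?_
    rw [hRdef]
    gcongr
  have he : 0 ≤ 1 - Real.exp (-1) := by
    rw [sub_nonneg, Real.exp_le_one_iff]
    norm_num
  have he1 : (1 - Real.exp (-1)) * L ≤ L :=
    mul_le_of_le_one_left hLr.le (by linarith [Real.exp_pos (-1)])
  have htotal : ∑ q ∈ Finset.Ico q₀ q₁, ∑ p : Fin L, (Real.exp (-1) * f (q * L + p) y -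
      ∫ ω, f (q * L + p) (X (q * L + p) ω) ∂P) ≤ L * R + N * (M₁ * D) := by
    refine (Finset.sum_le_sum hblock).trans ?_
    rw [Finset.sum_add_distrib, ← Finset.mul_sum, Finset.sum_const, Nat.card_Ico, nsmul_eq_mul,
      Nat.cast_sub hq]
    gcongr ?_ + ?_
    -- The linear sum may be negative, so it is bounded by `R ≥ 0` before the factor 1 - 1/e is
    -- dropped.
    · exact (mul_le_mul_of_nonneg_left hR' (by positivity)).trans
        (mul_le_mul_of_nonneg_right he1 hR0)
    · gcongr
  linarith

end Blocks

/-! ### Orders of growth of the block size, the number of blocks and the regret. -/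

section Rates

lemma one_le_rpow_third {T : ℕ} (hT : 1 ≤ T) : 1 ≤ (T : ℝ) ^ (1 / 3 : ℝ) :=
  Real.one_le_rpow (by exact_mod_cast hT) (by norm_num)

lemma rpow_third_sq (T : ℕ) : ((T : ℝ) ^ (1 / 3 : ℝ)) ^ 2 = (T : ℝ) ^ (2 / 3 : ℝ) := by
  rw [← Real.rpow_natCast, ← Real.rpow_mul (Nat.cast_nonneg T)]
  norm_num

lemma blockSize_le {T : ℕ} (hT : 1 ≤ T) : (blockSize T : ℝ) ≤ 2 * (T : ℝ) ^ (1 / 3 : ℝ) := by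
  have h1 := one_le_rpow_third hT
  have h2 := Nat.ceil_lt_add_one (zero_le_one.trans h1)
  simp only [blockSize]
  linarith

lemma div_le_numBlocks (T : ℕ) : (T : ℝ) / blockSize T ≤ numBlocks T := Nat.le_ceil _

lemma numBlocks_pos {T : ℕ} (hT : 1 ≤ T) : 0 < numBlocks T := by
  have h1 : (0 : ℝ) < T := by exact_mod_cast hT
  have h2 : (0 : ℝ) < blockSize T := by exact_mod_cast blockSize_pos hT
  exact Nat.ceil_pos.2 (div_pos h1 h2)

lemma numBlocks_le {T : ℕ} (hT : 1 ≤ T) :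
    (numBlocks T : ℝ) ≤ 2 * ((T : ℝ) ^ (1 / 3 : ℝ)) ^ 2 := by
  set τ := (T : ℝ) ^ (1 / 3 : ℝ) with hτ
  have h1 : 1 ≤ τ := one_le_rpow_third hT
  have h2 : τ ≤ blockSize T := Nat.le_ceil _
  have h3 : τ ^ 3 = T := by
    rw [hτ, ← Real.rpow_natCast, ← Real.rpow_mul (Nat.cast_nonneg T)]
    norm_num
  have h4 : (T : ℝ) / blockSize T ≤ τ ^ 2 := by
    -- Here `T = τ ^ 3` and the block size is at least `τ`; rounding up then adds at most `1 ≤ τ ^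
    -- 2`.
    rw [div_le_iff₀ (by linarith), ← h3, pow_succ]
    gcongr
  have h5 := Nat.ceil_lt_add_one (div_nonneg (Nat.cast_nonneg T)
    (Nat.cast_nonneg (blockSize T)) : (0 : ℝ) ≤ (T : ℝ) / blockSize T)
  have h6 : 1 ≤ τ ^ 2 := one_le_pow₀ h1
  simp only [numBlocks]
  linarith

/-- With the tuned parameters the regret bound is of order `T ^ (2 / 3)`. -/
lemma regret_rate {D r v M B L N s τ : ℝ} (hD : 0 < D) (hr : 0 < r) (hv : 0 < v) (hM : 0 ≤ M)
    (hB : 0 < B) (hτ : 1 ≤ τ) (hL : L ≤ 2 * τ) (hN : N ≤ 2 * τ ^ 2) (hs : 0 < s)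
    (hsN : s ^ 2 = N) :
    2 * L * (M * D) + N * (M * D) +
        L * (D ^ 2 / (2 * (v * r / (2 * B) * s⁻¹)) +
          N * (v * r / (2 * B) * s⁻¹ * B ^ 2 / 2 + B * (v * s⁻¹ / r * D))) ≤
      (6 * D + 4 * (D ^ 2 / (v * r) + v * r / 4 + v * D / r)) * (M + B) * τ ^ 2 := by
  set k := D ^ 2 / (v * r) + v * r / 4 + v * D / r with hk
  have hk0 : 0 ≤ k := by positivity
  -- With `N = s ^ 2` the tuning makes all three terms proportional to `s * B`, and `k` collects
  -- their coefficients.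
  have h1 : D ^ 2 / (2 * (v * r / (2 * B) * s⁻¹)) +
      N * (v * r / (2 * B) * s⁻¹ * B ^ 2 / 2 + B * (v * s⁻¹ / r * D)) = s * B * k := by
    rw [hk, ← hsN]
    field_simp
    ring
  have hs2 : s ≤ 2 * τ := by
    refine le_of_sq_le_sq ?_ (by linarith)
    nlinarith [sq_nonneg τ]
  have h2 : L * (s * B * k) ≤ 2 * τ * (2 * τ * B * k) := by gcongr
  have h3 : L ≤ 2 * τ ^ 2 := by nlinarith
  have h4 : 2 * L * (M * D) ≤ 2 * (2 * τ ^ 2) * (M * D) := by gcongr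
  have h5 : N * (M * D) ≤ 2 * τ ^ 2 * (M * D) := by gcongr
  -- The cross terms by which the product with `M + B` exceeds what is needed.
  have h6 : 0 ≤ 6 * D * B * τ ^ 2 + 4 * k * M * τ ^ 2 := by positivity
  rw [h1]
  linarith

end Rates

/-! ### From fixed comparators to static and adaptive regret. -/

lemma regretOn_le {d : ℕ} {Ω : Type*} [MeasurableSpace Ω] {P : Measure Ω} {α R : ℝ} (hα : 0 < α)
    {K : Set (EuclideanSpace ℝ (Fin d))} (hK : K.Nonempty)
    {f : ℕ → EuclideanSpace ℝ (Fin d) → ℝ} {X : ℕ → Ω → EuclideanSpace ℝ (Fin d)} {I : Finset ℕ}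
    (h : ∀ y ∈ K, ∑ t ∈ I, (α * f t y - ∫ ω, f t (X t ω) ∂P) ≤ R) :
    regretOn P α K f X I ≤ R := by
  have h1 : sSup ((fun y => ∑ t ∈ I, f t y) '' K) ≤
      (R + ∑ t ∈ I, ∫ ω, f t (X t ω) ∂P) / α := by
    refine csSup_le (hK.image _) ?_
    rintro _ ⟨y, hy, rfl⟩
    have h2 := h y hy
    rw [Finset.sum_sub_distrib, ← Finset.mul_sum] at h2
    rw [le_div_iff₀ hα]
    linarith
  rw [le_div_iff₀ hα] at h1
  rw [regretOn]
  linarith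

theorem proposition4 (D r v : ℝ) (hD : 0 < D) (hr : 0 < r) (hv : 0 < v) :
    ∃ C : ℝ, ∀ (d : ℕ) (K : Set (EuclideanSpace ℝ (Fin d))) (c : EuclideanSpace ℝ (Fin d))
      (SO : EuclideanSpace ℝ (Fin d) → EuclideanSpace ℝ (Fin d)) (M₁ B₁ Λ : ℝ)
      (T : ℕ) (hT : 1 ≤ T) (f : ℕ → EuclideanSpace ℝ (Fin d) → ℝ) (δ η : ℝ)
      (Ω : Type*) (_ : MeasurableSpace Ω) (P : Measure Ω)
      (z : ℕ → Ω → ℝ) (π : ℕ → Ω → Equiv.Perm (Fin (blockSize T)))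
      (o X : ℕ → Ω → EuclideanSpace ℝ (Fin d)),
      IsConstraintSet K D →
      c ∈ K → Metric.ball c r ∩ (affineSpan ℝ K : Set (EuclideanSpace ℝ (Fin d))) ⊆ K →
      IsSeparationOracle K SO → Measurable SO →
      0 < B₁ →
      (∀ t < T, IsObjective K M₁ Λ (f t)) →
      δ = v * (numBlocks T : ℝ) ^ (-(1 / 2) : ℝ) → δ < r →
      η = v * r / (2 * B₁) * (numBlocks T : ℝ) ^ (-(1 / 2) : ℝ) →
      IsProbabilityMeasure P →
      (∀ t ω, X t ω = playedAction K c D SO δ η (blockSize_pos hT)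
        (fun q => z q ω) (fun q => π q ω) (fun s => o s ω) t) →
      IsSemiBanditRun P T B₁ f z π o X →
      (∀ t < T, (∀ᵐ ω ∂P, X t ω ∈ K) ∧ Integrable (fun ω => f t (X t ω)) P) ∧
      staticRegret P (Real.exp (-1)) K f X T ≤ C * (M₁ + B₁) * (T : ℝ) ^ (2 / 3 : ℝ) ∧
      adaptiveRegret P (Real.exp (-1)) K f X T ≤ C * (M₁ + B₁) * (T : ℝ) ^ (2 / 3 : ℝ) := by
  -- From `L ≤ 2τ`, `N ≤ 2τ²` and `s ≤ 2τ` with τ = T^{1/3} ≥ 1: `2L + N ≤ 6τ²` multiplies `M₁ * D`,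
  -- and `L * s ≤ 4τ²` multiplies the linear regret.
  refine ⟨6 * D + 4 * (D ^ 2 / (v * r) + v * r / 4 + v * D / r), ?_⟩
  intro d K c SO M₁ B₁ Λ T hT f δ η Ω _ P z π o X hK hc hball hSO hSOm hB hf hδ hδr hη hP hX hrun
  have hNpos : (0 : ℝ) < numBlocks T := by exact_mod_cast numBlocks_pos hT
  set s : ℝ := (numBlocks T : ℝ) ^ (1 / 2 : ℝ) with hs
  have hs0 : 0 < s := Real.rpow_pos_of_pos hNpos _
  have hsinv : (numBlocks T : ℝ) ^ (-(1 / 2) : ℝ) = s⁻¹ := Real.rpow_neg hNpos.le _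
  have hsN : s ^ 2 = numBlocks T := by
    rw [hs, ← Real.rpow_natCast, ← Real.rpow_mul hNpos.le]
    norm_num
  rw [hsinv] at hδ hη
  have hM : 0 ≤ M₁ := (norm_nonneg _).trans ((hf 0 hT).lipschitz c hc)
  have hr' : IsBlockingRun P K c D r SO M₁ B₁ Λ T f δ η (blockSize_pos hT) z π o X :=
    ⟨hK, hc, margin_center hball hc, hSO, hSOm, hD, by rw [hδ]; positivity, hδr,
      by rw [hη]; positivity, hf, hP, hX, hrun⟩
  have hgap : ∀ a b : ℕ, b < T → regretOn P (Real.exp (-1)) K f X (Finset.Icc a b) ≤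
      (6 * D + 4 * (D ^ 2 / (v * r) + v * r / 4 + v * D / r)) * (M₁ + B₁) *
        (T : ℝ) ^ (2 / 3 : ℝ) := by
    intro a b hb
    refine regretOn_le (Real.exp_pos _) ⟨c, hc⟩ fun y hy => ?_
    refine (hr'.sum_gap_le hM hB.le (div_le_numBlocks T) hb hy).trans ?_
    rw [hδ, hη, ← rpow_third_sq]
    exact regret_rate hD hr hv hM hB (one_le_rpow_third hT)
      (blockSize_le hT) (numBlocks_le hT) hs0 hsN
  refine ⟨fun t ht => ⟨hr'.ae_played_mem ht, hr'.integrable_played ht⟩, ?_, ?_⟩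
  · have hrange : Finset.range T = Finset.Icc 0 (T - 1) := by
      ext t
      simp only [Finset.mem_range, Finset.mem_Icc]
      omega
    rw [staticRegret, hrange]
    exact hgap 0 (T - 1) (by omega)
  · refine csSup_le ⟨_, 0, 0, le_rfl, hT, rfl⟩ ?_
    rintro _ ⟨a, b, -, hb, rfl⟩
    exact hgap a b hb
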